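/- Let $n\ge 2$, let $M$ be a connected smooth $n$-dimensional manifold (for instance $M=\mathbb S^l_{r_1}\times\mathbb S^{n-l}_{r_2}$), and let $F:M\to\mathbb S^{n+1}\subset\mathbb R^{n+2}$ be a smoothly immersed hypersurface with smooth unit normal field $N$ (tangent to $\mathbb S^{n+1}$). Write $g(v,w)=\langle dF(v),dF(w)\rangle$ and $h(v,w)=-\langle dN(v),dF(w)\rangle$; the principal curvatures are the eigenvalues of $h$ with respect to $g$, and the mean curvature $H$ is their sum, counted with multiplicity. Suppose that $F$ is isoparametric (its principal curvatures are constant) with exactly two distinct principal curvatures $\kappa_1,\kappa_2$, of multiplicities $l$ and $n-l$, where $1\le l\le n-1$. A family $\widehat F^t$ of immersed hypersurfaces of $\mathbb S^{n+1}$, $t$ in an interval containing $0$, solves the mean curvature flow with initial data $F$ if $\widehat F^0=F$ and $\partial_t\widehat F^t=\widehat H^t\widehat N^t$, where $\widehat N^t$ is a unit normal field of $\widehat F^t$ and $\widehat H^t$ its mean curvature; it is a solution by parallel hypersurfaces if moreover $\widehat F^t=\cos(\xi(t))F+\sin(\xi(t))N$ for some function $\xi$ with $\xi(0)=0$. Then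 the following hold. 1. $\kappa_1\kappa_2=-1$. 2. If $F$ is not minimal (that is, $H\not\equiv 0$), then after possibly replacing $N$ by $-N$ (so that $\kappa_1,\kappa_2$ change sign) and possibly exchanging $(\kappa_1,l)$ with $(\kappa_2,n-l)$, one has $\kappa_1>\sqrt{(n-l)/l}$. 3. Assume $\kappa_1>\sqrt{(n-l)/l}$ and put $$a=\kappa_1+\kappa_2,\qquad b=-\frac{n-2l}{n}(\kappa_1-\kappa_2),\qquad q(t)=(a+b)e^{2nt}-b,\qquad t^*=\frac1{2n}\ln\left(\frac{l(\kappa_1^2+1)}{l(\kappa_1^2+1)-n}\right).$$ Then $l(\kappa_1^2+1)-n>0$, $t^*>0$, and there is a smooth function $\xi:[0,t^*)\to\mathbb R$ with $\xi(0)=0$ such that for all $t\in[0,t^*)$ one has $a^2+4-q(t)^2>0$ and $$\cos(2\xi(t))=\frac{a\,q(t)+2\sqrt{a^2+4-q(t)^2}}{a^2+4},\qquad \sin(2\xi(t))=\frac{2q(t)-a\sqrt{a^2+4-q(t)^2}}{a^2+4},$$ and such that $\widehat F^t=\cos(\xi(t))F+\sin(\xi(t))N$, $t\in[0,t^*)$,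 solves the mean curvature flow with initial data $F$. It is the only solution by parallel hypersurfaces: any such solution on an interval $[0,T)$, $T>0$, satisfies $T\le t^*$ and coincides with $\widehat F^t$ on $[0,T)$. Moreover, the solution collapses into an $(n-l)$-dimensional focal submanifold of $F$ at $t^*$: as $t\uparrow t^*$, $\xi(t)\to\theta$, where $\theta\in(0,\pi/2)$ and $\cot\theta=\kappa_1$; the maps $\widehat F^t$ converge uniformly to $\widehat F^{t^*}=\cos\theta\,F+\sin\theta\,N$, which has constant rank $n-l<n$ (so every $\widehat F^{t^*}(x)$ is a focal point of $F$ at $x$); and the image $\widehat F^{t^*}(M)$ is an embedded smooth $(n-l)$-dimensional submanifold of $\mathbb R^{n+2}$ contained in $\mathbb S^{n+1}$. -/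

import Mathlib

open Set Filter Topology Module
open scoped Manifold ContDiff

noncomputable section

/-- The ambient Euclidean space `ℝ^{n+2}` of the unit sphere `𝕊^{n+1}`. -/
abbrev Amb (n : ℕ) : Type := EuclideanSpace ℝ (Fin (n + 2))

section Hypersurfaces

variable {n : ℕ} {E : Type*} [NormedAddCommGroup E] [NormedSpace ℝ E]
  {H : Type*} [TopologicalSpace H] (I : ModelWithCorners ℝ E H)
  {M : Type*} [TopologicalSpace M] [ChartedSpace H M]

/-- The differential at `x` of a map `F : M → ℝ^{n+2}`, with values in `ℝ^{n+2}`. -/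
def differential (F : M → Amb n) (x : M) : TangentSpace I x →L[ℝ] Amb n :=
  mfderiv I 𝓘(ℝ, Amb n) F x

/-- The metric `g(v, w) = ⟨dF v, dF w⟩` induced by `F`. -/
def inducedMetric (F : M → Amb n) (x : M) (v w : TangentSpace I x) : ℝ :=
  inner ℝ (differential I F x v) (differential I F x w)

/-- The second fundamental form `h(v, w) = -⟨dN v, dF w⟩`. -/
def secondFundamentalForm (F N : M → Amb n) (x : M) (v w : TangentSpace I x) : ℝ :=
  -inner ℝ (differential I N x v) (differential I F x w)

/-- `F : M → 𝕊^{n+1} ⊆ ℝ^{n+2}` is a smoothly immersed hypersurface of the unit sphere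
(`dim M = n`), oriented by the smooth unit normal field `N` (normal to `F` and tangent to the
sphere). -/
structure IsOrientedHypersurface (F N : M → Amb n) : Prop where
  finrank_eq : finrank ℝ E = n
  smooth : ContMDiff I 𝓘(ℝ, Amb n) ∞ F
  immersion : ∀ x, Function.Injective (differential I F x)
  mem_sphere : ∀ x, ‖F x‖ = 1
  smooth_normal : ContMDiff I 𝓘(ℝ, Amb n) ∞ N
  norm_normal : ∀ x, ‖N x‖ = 1
  normal_tangent_sphere : ∀ x, inner ℝ (N x) (F x) = 0
  normal_orthogonal : ∀ x v, inner ℝ (N x) (differential I F x v) = 0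

/-- `κ₁, …, κₙ` are the principal curvatures at `x`, listed with multiplicity: some `g`-orthonormal
vectors `e₁, …, eₙ` of `T_xM` satisfy `h(eᵢ, eⱼ) = κᵢ δᵢⱼ`. -/
def HasPrincipalCurvatures (F N : M → Amb n) (x : M) (κ : Fin n → ℝ) : Prop :=
  ∃ e : Fin n → TangentSpace I x, ∀ i j,
    inducedMetric I F x (e i) (e j) = (if i = j then 1 else 0) ∧
    secondFundamentalForm I F N x (e i) (e j) = (if i = j then κ i else 0)

/-- `η` is the mean curvature (the sum of the principal curvatures) at `x`. -/
def HasMeanCurvature (F N : M → Amb n) (x : M) (η : ℝ) : Prop :=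
  ∃ κ : Fin n → ℝ, HasPrincipalCurvatures I F N x κ ∧ η = ∑ i, κ i

/-- The mean curvature vanishes identically. -/
def IsMinimalHypersurface (F N : M → Amb n) : Prop :=
  ∀ x, HasMeanCurvature I F N x 0

/-- Isoparametric: the principal curvatures `κ₁, …, κₙ` do not depend on the point. -/
def IsIsoparametric (F N : M → Amb n) (κ : Fin n → ℝ) : Prop :=
  ∀ x, HasPrincipalCurvatures I F N x κ

/-- `F` is isoparametric with exactly two distinct principal curvatures, `κ₁` of multiplicity `l`
and `κ₂` of multiplicity `n - l`. -/
def IsIsoparametricTwo (F N : M → Amb n) (κ₁ κ₂ : ℝ) (l : ℕ) : Prop :=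
  0 < l ∧ l < n ∧ κ₁ ≠ κ₂ ∧ ∃ κ : Fin n → ℝ, IsIsoparametric I F N κ ∧
    (∀ i, κ i = κ₁ ∨ κ i = κ₂) ∧
    {i | κ i = κ₁}.ncard = l ∧ {i | κ i = κ₂}.ncard = n - l

/-- The parallel map `x ↦ cos θ F(x) + sin θ N(x)` at oriented distance `θ`. -/
def parallelMap (F N : M → Amb n) (θ : ℝ) (x : M) : Amb n :=
  Real.cos θ • F x + Real.sin θ • N x

/-- `Fhat`, defined for times in `J`, is a solution in `𝕊^{n+1}` of the mean curvature flow
`∂Fhat/∂t = Hhat Nhat` with initial condition `F`; at each time, `Nhat` is a unit normal field of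
`Fhat t` and `Hhat` the corresponding mean curvature (the product does not depend on the choice
of the sign of the normal). -/
def IsMCF (F : M → Amb n) (Fhat : ℝ → M → Amb n) (J : Set ℝ) : Prop :=
  Fhat 0 = F ∧ ∀ t ∈ J, ∃ Nhat : M → Amb n, IsOrientedHypersurface I (Fhat t) Nhat ∧
    ∀ x, ∃ Hhat : ℝ, HasMeanCurvature I (Fhat t) Nhat x Hhat ∧
      HasDerivWithinAt (fun s => Fhat s x) (Hhat • Nhat x) J t

/-- A solution of the mean curvature flow by hypersurfaces parallel to the initial one. -/
def IsParallelMCF (F N : M → Amb n) (Fhat : ℝ → M → Amb n) (J : Set ℝ) : Prop :=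
  IsMCF I F Fhat J ∧ ∃ ξ : ℝ → ℝ, ξ 0 = 0 ∧ ∀ t ∈ J, Fhat t = parallelMap F N (ξ t)

/-- `S ⊆ ℝ^{n+2}` is a smooth embedded `k`-dimensional submanifold: near each of its points it is
the zero set of a smooth submersion onto `ℝ^c`, where `k + c = n + 2`. -/
def IsEmbeddedSubmanifold (k : ℕ) (S : Set (Amb n)) : Prop :=
  ∃ c : ℕ, k + c = n + 2 ∧ ∀ p ∈ S, ∃ (U : Set (Amb n)) (Φ : Amb n → EuclideanSpace ℝ (Fin c)),
    IsOpen U ∧ p ∈ U ∧ ContDiffOn ℝ ∞ Φ U ∧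
    (∀ y ∈ U, Function.Surjective (fderiv ℝ Φ y)) ∧ S ∩ U = {y ∈ U | Φ y = 0}

/-- `cos θ F(x) + sin θ N(x)` is a focal point of the hypersurface on the normal geodesic at `x`:
the parallel map at distance `θ` fails to be an immersion at `x`. -/
def IsFocalAt (F N : M → Amb n) (θ : ℝ) (x : M) : Prop :=
  ¬ Function.Injective (differential I (parallelMap F N θ) x)

/-- `S` is a `k`-dimensional focal submanifold of the hypersurface: an embedded `k`-dimensional
submanifold of the sphere which is the image of a parallel map of constant rank `k` all of whose
values are focal points. -/
def IsFocalSubmanifold (F N : M → Amb n) (k : ℕ) (S : Set (Amb n)) : Prop :=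
  IsEmbeddedSubmanifold k S ∧ S ⊆ Metric.sphere 0 1 ∧
    ∃ θ : ℝ, S = range (parallelMap F N θ) ∧
      ∀ x, IsFocalAt I F N θ x ∧
        finrank ℝ (differential I (parallelMap F N θ) x).range = k

end Hypersurfaces

end

/-! Everything rests on the two focal maps `p = N + κ₁ F` and `q = N + κ₂ F`. By Weingarten's
formula `dp` kills the κ₁-eigenspace and multiplies `dF` by `κ₁ - κ₂` on the κ₂-eigenspace; `dq`
does the same with the roles exchanged. Hence `dp` and `dq` have orthogonal images.

Differentiating this orthogonality once, with the symmetry of second derivatives, gives `D²p ⟂ im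
dq` (`inner_snd_fderiv_eq_zero`), a form of Codazzi's equation. Differentiating again, with the
symmetry of third derivatives, compares `⟨D²p(X,X), D²q(Y,Y)⟩` with `⟨D²p(Y,X), D²q(X,Y)⟩`. Only the
components along `F` and `N` contribute, and these are explicit; the result is `κ₁ κ₂ = -1`
(`mul_eq_neg_one`).

Then `⟨p, q⟩ = 1 + κ₁ κ₂ = 0`, so `D²p` is orthogonal to `q` and to `im dq`, hence lies in `span p +
im dp`. This space is therefore parallel: for fixed `w` the 1-jet of `⟨w, p⟩` obeys a linear
differential inequality along segments, and Grönwall with connectedness shows that the space is one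
fixed `V` of dimension `n - l + 1` (`focalSpan_eq`). The focal map, a multiple of `p`, is a
submersion onto an open part of the unit sphere of `V`, so its image is an embedded submanifold
(`isEmbeddedSubmanifold_range`).

For the flow, the parallel hypersurface at distance `ξ` is immersed iff `P = 2 (cos ξ - κ₁ sin
ξ)(cos ξ - κ₂ sin ξ)` is nonzero, and the flow becomes `ξ' = H(ξ)`. With `a = κ₁ + κ₂` and `Q = a
cos 2ξ + 2 sin 2ξ` one has `P = 2 cos 2ξ - a sin 2ξ`, `P² + Q² = a² + 4`, `Q' = 2 P ξ'` and `P H = n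
(Q + b)`. So `Q' = 2n (Q + b)` is linear and `Q = q(t)` (`angle_equation_solution`). Since `P` stays
positive, `Q` determines the angle modulo `2π` (`angle_unique`), and inverting `Q` gives existence
(`isParallelMCF_focalAngle`). The flow ends when `q² = a² + 4`, that is `P = 0`: this is time `t*`,
and the limit angle satisfies `cot θ = κ₁` (`focalAngle_sqrt`). -/

noncomputable section

/-! ### Linear algebra of adapted and principal frames at one point. -/

section AdaptedFrames

variable {n : ℕ} {T : Type*} [AddCommGroup T] [Module ℝ T]

/-- The orthonormal frame `f, ν, A e₁, …, A eₙ` of `ℝ^{n+2}`. -/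
structure IsAdaptedFrame (A : T →ₗ[ℝ] Amb n) (f ν : Amb n) (e : Fin n → T) : Prop where
  norm_f : ‖f‖ = 1
  norm_ν : ‖ν‖ = 1
  inner_f_ν : inner ℝ f ν = 0
  inner_f : ∀ i, inner ℝ f (A (e i)) = 0
  inner_ν : ∀ i, inner ℝ ν (A (e i)) = 0
  orthonormal : ∀ i j, inner ℝ (A (e i)) (A (e j)) = if i = j then 1 else 0

namespace IsAdaptedFrame

variable {A B : T →ₗ[ℝ] Amb n} {f ν : Amb n} {e : Fin n → T} {κ : Fin n → ℝ}

/-- Parseval's identity: the frame consists of `n + 2` orthonormal vectors in dimension `n + 2`, so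
it is an orthonormal basis. -/
theorem inner_eq_sum (h : IsAdaptedFrame A f ν e) (z w : Amb n) :
    inner ℝ z w = inner ℝ z f * inner ℝ f w + inner ℝ z ν * inner ℝ ν w +
      ∑ i, inner ℝ z (A (e i)) * inner ℝ (A (e i)) w := by
  let u : Option (Option (Fin n)) → Amb n :=
    fun o => o.elim f (fun o => o.elim ν (fun i => A (e i)))
  have hνf : inner ℝ ν f = (0 : ℝ) := by rw [real_inner_comm, h.inner_f_ν]
  have h1 : ∀ i, inner ℝ (A (e i)) f = (0 : ℝ) := fun i => by
    rw [real_inner_comm, h.inner_f]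
  have h2 : ∀ i, inner ℝ (A (e i)) ν = (0 : ℝ) := fun i => by
    rw [real_inner_comm, h.inner_ν]
  have hu : Orthonormal ℝ u := by
    rw [orthonormal_iff_ite]
    rintro (_ | _ | i) (_ | _ | j) <;>
      simp [u, h.norm_f, h.norm_ν, hνf, h1, h2, h.inner_f_ν, h.inner_f, h.inner_ν, h.orthonormal]
  have hspan : ⊤ ≤ Submodule.span ℝ (range u) := by
    have := hu.linearIndependent.span_eq_top_of_card_eq_finrank' (by simp)
    rw [this]
  have := (OrthonormalBasis.mk hu hspan).sum_inner_mul_inner z w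
  simp only [OrthonormalBasis.coe_mk, Fintype.sum_option] at this
  simp only [u, Option.elim] at this
  linarith

theorem eq_zero (h : IsAdaptedFrame A f ν e) {z : Amb n} (hf : inner ℝ f z = 0)
    (hν : inner ℝ ν z = 0) (he : ∀ i, inner ℝ (A (e i)) z = 0) : z = 0 := by
  have := h.inner_eq_sum z z
  simpa [hf, hν, he] using this

theorem eq_sum (h : IsAdaptedFrame A f ν e) (z : Amb n) :
    z = inner ℝ f z • f + inner ℝ ν z • ν + ∑ i, inner ℝ (A (e i)) z • A (e i) := by
  refine ext_inner_right ℝ fun w => ?_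
  rw [h.inner_eq_sum z w]
  simp only [inner_add_left, sum_inner, inner_smul_left, RCLike.conj_to_real,
    real_inner_comm z]

theorem linearIndependent_comp (h : IsAdaptedFrame A f ν e) :
    LinearIndependent ℝ (fun i => A (e i)) :=
  (orthonormal_iff_ite.2 h.orthonormal).linearIndependent

theorem linearIndependent (h : IsAdaptedFrame A f ν e) : LinearIndependent ℝ e :=
  LinearIndependent.of_comp A h.linearIndependent_comp

/-- Weingarten's formula. -/
theorem weingarten (h : IsAdaptedFrame A f ν e) (hf : ∀ v, inner ℝ f (B v) = 0)
    (hν : ∀ v, inner ℝ ν (B v) = 0)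
    (hB : ∀ i j, -inner ℝ (B (e i)) (A (e j)) = if i = j then κ i else 0) (i : Fin n) :
    B (e i) = -κ i • A (e i) := by
  rw [← sub_eq_zero]
  refine h.eq_zero ?_ ?_ fun j => ?_
  · rw [inner_sub_right, inner_smul_right, hf, h.inner_f, mul_zero, sub_zero]
  · rw [inner_sub_right, inner_smul_right, hν, h.inner_ν, mul_zero, sub_zero]
  · have := hB i j
    rw [inner_sub_right, inner_smul_right, h.orthonormal, real_inner_comm]
    split_ifs at this ⊢ with h1 h2 h2 <;> first | linarith | (exact absurd h1.symm h2) | (exact absurd h2.symm h1)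

variable [FiniteDimensional ℝ T]

theorem span_eq_top (h : IsAdaptedFrame A f ν e) (hT : finrank ℝ T = n) :
    Submodule.span ℝ (range e) = ⊤ :=
  h.linearIndependent.span_eq_top_of_card_eq_finrank' (by simp [hT])

theorem exists_sum (h : IsAdaptedFrame A f ν e) (hT : finrank ℝ T = n) (v : T) :
    ∃ c : Fin n → ℝ, v = ∑ i, c i • e i := by
  have hv : v ∈ Submodule.span ℝ (range e) := by rw [h.span_eq_top hT]; trivial
  obtain ⟨c, hc⟩ := (Submodule.mem_span_range_iff_exists_fun ℝ).1 hv
  exact ⟨c, hc.symm⟩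

theorem eq_sum_tangent (h : IsAdaptedFrame A f ν e) (hT : finrank ℝ T = n) (v : T) :
    v = ∑ i, inner ℝ (A (e i)) (A v) • e i := by
  obtain ⟨c, rfl⟩ := h.exists_sum hT v
  refine Finset.sum_congr rfl fun i _ => ?_
  simp [map_sum, inner_sum, inner_smul_right, h.orthonormal]

theorem injective (h : IsAdaptedFrame A f ν e) (hT : finrank ℝ T = n) :
    Function.Injective A := by
  refine (injective_iff_map_eq_zero A).2 fun v hv => ?_
  rw [h.eq_sum_tangent hT v]
  simp [hv]

theorem inner_f_apply (h : IsAdaptedFrame A f ν e) (hT : finrank ℝ T = n) (v : T) :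
    inner ℝ f (A v) = 0 := by
  obtain ⟨c, rfl⟩ := h.exists_sum hT v
  simp [map_sum, inner_sum, inner_smul_right, h.inner_f]

theorem inner_ν_apply (h : IsAdaptedFrame A f ν e) (hT : finrank ℝ T = n) (v : T) :
    inner ℝ ν (A v) = 0 := by
  obtain ⟨c, rfl⟩ := h.exists_sum hT v
  simp [map_sum, inner_sum, inner_smul_right, h.inner_ν]

end IsAdaptedFrame

/-- An adapted frame of principal vectors `e₁, …, eₙ`, with principal curvatures `κ₁, …, κₙ`. -/
structure IsPrincipalFrame (A B : T →ₗ[ℝ] Amb n) (f ν : Amb n) (κ : Fin n → ℝ)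
    (e : Fin n → T) : Prop extends IsAdaptedFrame A f ν e where
  weingarten : ∀ i, B (e i) = -κ i • A (e i)

namespace IsPrincipalFrame

variable {A B : T →ₗ[ℝ] Amb n} {f ν : Amb n} {e : Fin n → T} {κ : Fin n → ℝ} {κ₁ κ₂ : ℝ}

/-- The differential of the focal map `ν + c f` is diagonal in the principal frame; for `c = κ₁` it
kills exactly the κ₁-directions. -/
theorem add_smul_apply (h : IsPrincipalFrame A B f ν κ e) (c : ℝ) (i : Fin n) :
    B (e i) + c • A (e i) = (c - κ i) • A (e i) := by
  rw [h.weingarten]; module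

/-- The vectors orthogonal to `ν + κ₂ f` and to the image of its differential are spanned by
`ν + κ₁ f` and the image of its differential. -/
theorem exists_eq_focal (h : IsPrincipalFrame A B f ν κ e)
    (hκ : ∀ i, κ i = κ₁ ∨ κ i = κ₂) (hne : κ₁ ≠ κ₂) (hκκ : κ₁ * κ₂ = -1) {z : Amb n}
    (hz : inner ℝ (ν + κ₂ • f) z = 0) (hz' : ∀ v, inner ℝ (B v + κ₂ • A v) z = 0) :
    ∃ Y, B Y + κ₂ • A Y = 0 ∧
      z = (inner ℝ (ν + κ₁ • f) z / (1 + κ₁ ^ 2)) • (ν + κ₁ • f) + (B Y + κ₁ • A Y) := by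
  classical
  have hne' : κ₁ - κ₂ ≠ 0 := sub_ne_zero.2 hne
  -- `Y` is chosen in the κ₂-eigenspace, where `B + κ₁ A` acts as `(κ₁ - κ₂) A`; hence the divisor.
  refine ⟨∑ i with ¬ κ i = κ₁, (inner ℝ (A (e i)) z / (κ₁ - κ₂)) • e i, ?_, ?_⟩
  · simp only [map_sum, map_smul, Finset.smul_sum, ← Finset.sum_add_distrib]
    refine Finset.sum_eq_zero fun i hi => ?_
    rw [smul_comm, ← smul_add, h.add_smul_apply,
      (hκ i).resolve_left (Finset.mem_filter.1 hi).2]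
    simp
  · have h1 : inner ℝ ν z = -κ₂ * inner ℝ f z := by
      rw [inner_add_left, inner_smul_left] at hz
      simp only [RCLike.conj_to_real] at hz
      linarith
    -- In the plane of `f` and `ν`, the vectors `ν + κ₁ f` and `ν + κ₂ f` are orthogonal because `1
    -- + κ₁ κ₂ = 0`, and the first has squared norm `1 + κ₁²`.
    have h2 : (inner ℝ (ν + κ₁ • f) z / (1 + κ₁ ^ 2)) • (ν + κ₁ • f) =
        inner ℝ f z • f + inner ℝ ν z • ν := by
      have hpos : 1 + κ₁ ^ 2 ≠ 0 := by positivity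
      rw [inner_add_left, inner_smul_left, h1]
      simp only [RCLike.conj_to_real, smul_add, smul_smul]
      rw [add_comm]
      congr 2
      · field_simp
        linear_combination (-inner ℝ f z) * hκκ
      · field_simp
        linear_combination (κ₁ * inner ℝ f z) * hκκ
    rw [h2]
    nth_rw 1 [h.eq_sum z]
    congr 1
    simp only [map_sum, map_smul, Finset.smul_sum, ← Finset.sum_add_distrib]
    rw [← Finset.sum_filter_add_sum_filter_not _ (fun i => κ i = κ₁)]
    rw [Finset.sum_eq_zero, zero_add]
    · refine Finset.sum_congr rfl fun i hi => ?_
      rw [smul_comm, ← smul_add, h.add_smul_apply,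
        (hκ i).resolve_left (Finset.mem_filter.1 hi).2, smul_smul]
      congr 1
      field_simp
    · intro i hi
      have := hz' (e i)
      rw [h.add_smul_apply, (Finset.mem_filter.1 hi).2, inner_smul_left] at this
      rcases mul_eq_zero.1 this with h3 | h3
      · simp only [RCLike.conj_to_real] at h3
        exact absurd (by linarith) hne'
      · rw [h3, zero_smul]

variable [FiniteDimensional ℝ T]

theorem inner_f_normal (h : IsPrincipalFrame A B f ν κ e) (hT : finrank ℝ T = n) (v : T) :
    inner ℝ f (B v) = 0 := by
  obtain ⟨c, rfl⟩ := h.exists_sum hT v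
  simp only [map_sum, map_smul, h.weingarten, inner_sum, inner_smul_right, h.inner_f, mul_zero,
    Finset.sum_const_zero]

theorem inner_ν_normal (h : IsPrincipalFrame A B f ν κ e) (hT : finrank ℝ T = n) (v : T) :
    inner ℝ ν (B v) = 0 := by
  obtain ⟨c, rfl⟩ := h.exists_sum hT v
  simp only [map_sum, map_smul, h.weingarten, inner_sum, inner_smul_right, h.inner_ν, mul_zero,
    Finset.sum_const_zero]

/-- The images of the two focal maps `ν + κ₁ f` and `ν + κ₂ f` are orthogonal. -/
theorem inner_focal_eq_zero (h : IsPrincipalFrame A B f ν κ e) (hT : finrank ℝ T = n)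
    (hκ : ∀ i, κ i = κ₁ ∨ κ i = κ₂) (v w : T) :
    inner ℝ (B v + κ₁ • A v) (B w + κ₂ • A w) = 0 := by
  have key : ∀ i j, inner ℝ (B (e i) + κ₁ • A (e i)) (B (e j) + κ₂ • A (e j)) = 0 := by
    intro i j
    rw [h.add_smul_apply, h.add_smul_apply, inner_smul_left, inner_smul_right, h.orthonormal]
    split_ifs with hij
    · subst hij
      rcases hκ i with hi | hi <;> simp [hi]
    · simp
  have hw : ∀ i w, inner ℝ (B (e i) + κ₁ • A (e i)) (B w + κ₂ • A w) = 0 := by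
    intro i w
    obtain ⟨c, rfl⟩ := h.exists_sum hT w
    have : B (∑ j, c j • e j) + κ₂ • A (∑ j, c j • e j) =
        ∑ j, c j • (B (e j) + κ₂ • A (e j)) := by
      simp only [map_sum, map_smul, Finset.smul_sum, ← Finset.sum_add_distrib]
      exact Finset.sum_congr rfl fun j _ => by module
    rw [this, inner_sum]
    simp only [inner_smul_right, key, mul_zero, Finset.sum_const_zero]
  obtain ⟨c, rfl⟩ := h.exists_sum hT v
  have : B (∑ j, c j • e j) + κ₁ • A (∑ j, c j • e j) =
      ∑ j, c j • (B (e j) + κ₁ • A (e j)) := by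
    simp only [map_sum, map_smul, Finset.smul_sum, ← Finset.sum_add_distrib]
    exact Finset.sum_congr rfl fun j _ => by module
  rw [this, sum_inner]
  simp only [inner_smul_left, hw, mul_zero, Finset.sum_const_zero]

/-- The tangent space is the sum of the two curvature eigenspaces. -/
theorem exists_add (h : IsPrincipalFrame A B f ν κ e) (hT : finrank ℝ T = n)
    (hκ : ∀ i, κ i = κ₁ ∨ κ i = κ₂) (v : T) :
    ∃ v₁ v₂, v = v₁ + v₂ ∧ B v₁ + κ₁ • A v₁ = 0 ∧ B v₂ + κ₂ • A v₂ = 0 := by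
  obtain ⟨c, rfl⟩ := h.exists_sum hT v
  classical
  refine ⟨∑ i with κ i = κ₁, c i • e i, ∑ i with ¬ κ i = κ₁, c i • e i,
    (Finset.sum_filter_add_sum_filter_not _ _ _).symm, ?_, ?_⟩
  · simp only [map_sum, map_smul, Finset.smul_sum, ← Finset.sum_add_distrib]
    refine Finset.sum_eq_zero fun i hi => ?_
    rw [smul_comm, ← smul_add, h.add_smul_apply, (Finset.mem_filter.1 hi).2]
    simp
  · simp only [map_sum, map_smul, Finset.smul_sum, ← Finset.sum_add_distrib]
    refine Finset.sum_eq_zero fun i hi => ?_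
    rw [smul_comm, ← smul_add, h.add_smul_apply,
      (hκ i).resolve_left (Finset.mem_filter.1 hi).2]
    simp

end IsPrincipalFrame

/-- The trace of a symmetric form does not depend on the orthonormal frame. -/
theorem sum_eq_of_diagonalizing {T : Type*} [AddCommGroup T] [Module ℝ T]
    [FiniteDimensional ℝ T] {n : ℕ} (hT : finrank ℝ T = n) (g h : T →ₗ[ℝ] T →ₗ[ℝ] ℝ) {e e' : Fin n → T} {κ κ' : Fin n → ℝ}
    (hg : ∀ i j, g (e i) (e j) = if i = j then 1 else 0)
    (hh : ∀ i j, h (e i) (e j) = if i = j then κ i else 0)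
    (hg' : ∀ i j, g (e' i) (e' j) = if i = j then 1 else 0)
    (hh' : ∀ i j, h (e' i) (e' j) = if i = j then κ' i else 0) :
    ∑ i, κ i = ∑ i, κ' i := by
  have hli : LinearIndependent ℝ e := by
    rw [Fintype.linearIndependent_iff]
    intro c hc i
    have : g (∑ j, c j • e j) (e i) = 0 := by rw [hc]; simp
    simpa [map_sum, hg] using this
  have hspan := hli.span_eq_top_of_card_eq_finrank' (by simp [hT])
  have hex : ∀ i, ∃ c : Fin n → ℝ, ∑ j, c j • e j = e' i := fun i =>
    (Submodule.mem_span_range_iff_exists_fun ℝ).1 (by rw [hspan]; trivial)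
  choose O hO using hex
  -- The transition matrix between the two frames is orthogonal; the trace formula needs orthonormal
  -- columns as well, which follow because a one-sided inverse of a square matrix is two-sided.
  have h1 : (Matrix.of O) * (Matrix.of O).transpose = 1 := by
    ext i j
    have := hg' i j
    rw [← hO, ← hO] at this
    simp only [map_sum, map_smul, LinearMap.sum_apply, LinearMap.smul_apply, hg, smul_eq_mul,
      mul_ite, mul_one, mul_zero, Finset.sum_ite_eq', Finset.mem_univ,
      if_true] at this
    rw [Matrix.mul_apply, Matrix.one_apply, ← this]
    simp [mul_comm]
  have h2 := mul_eq_one_comm.1 h1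
  have h3 : ∀ i, κ' i = ∑ j, O i j * O i j * κ j := fun i => by
    have := hh' i i
    rw [← hO] at this
    simp only [map_sum, map_smul, LinearMap.sum_apply, LinearMap.smul_apply, hh, smul_eq_mul,
      mul_ite, mul_zero, Finset.sum_ite_eq', Finset.mem_univ,
      if_true] at this
    rw [← this]
    exact Finset.sum_congr rfl fun j _ => by ring
  simp_rw [h3]
  rw [Finset.sum_comm]
  refine Finset.sum_congr rfl fun j _ => ?_
  have := congrFun (congrFun h2 j) j
  rw [Matrix.mul_apply, Matrix.one_apply_eq] at this
  simp only [Matrix.transpose_apply, Matrix.of_apply] at this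
  rw [← Finset.sum_mul, this, one_mul]

end AdaptedFrames

/-! ### Focal maps in a parametrization, the Codazzi equation and Cartan's identity. -/

section LocalGeometry

/-- The product rule for a locally constant inner product; every orthogonality relation below is
differentiated through it. -/
theorem inner_fderiv_add_inner_fderiv_eq_zero {E V : Type*} [NormedAddCommGroup E]
    [NormedSpace ℝ E] [NormedAddCommGroup V] [InnerProductSpace ℝ V] {u v : E → V} {y : E} {c : ℝ}
    (hu : DifferentiableAt ℝ u y) (hv : DifferentiableAt ℝ v y)
    (h : ∀ᶠ z in 𝓝 y, inner ℝ (u z) (v z) = c) (k : E) :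
    inner ℝ (fderiv ℝ u y k) (v y) + inner ℝ (u y) (fderiv ℝ v y k) = 0 := by
  have h1 : (fun z => inner ℝ (u z) (v z)) =ᶠ[𝓝 y] fun _ => c := h
  have h2 := fderiv_inner_apply (𝕜 := ℝ) hu hv k
  rw [h1.fderiv_eq, fderiv_fun_const] at h2
  simp only [Pi.zero_apply, zero_apply] at h2
  linarith

theorem fderiv_clm_apply_const {E V W : Type*} [NormedAddCommGroup E] [NormedSpace ℝ E]
    [NormedAddCommGroup V] [NormedSpace ℝ V] [NormedAddCommGroup W] [NormedSpace ℝ W]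
    {L : E → V →L[ℝ] W} {y : E} (hL : DifferentiableAt ℝ L y) (i : V) (k : E) :
    fderiv ℝ (fun z => L z i) y k = fderiv ℝ L y k i := by
  rw [fderiv_clm_apply hL (differentiableAt_const i)]
  simp

variable {n : ℕ} {E : Type*} [NormedAddCommGroup E] [NormedSpace ℝ E]

/-- A parametrized hypersurface of the unit sphere with constant principal curvatures. -/
structure IsLocalIsoparametric (U : Set E) (f ν : E → Amb n) (κ : Fin n → ℝ) : Prop where
  isOpen : IsOpen U
  smooth : ContDiffOn ℝ ∞ f U
  smooth_normal : ContDiffOn ℝ ∞ ν U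
  exists_frame : ∀ y ∈ U, ∃ e,
    IsPrincipalFrame (fderiv ℝ f y : E →ₗ[ℝ] Amb n) (fderiv ℝ ν y : E →ₗ[ℝ] Amb n) (f y) (ν y) κ e

/-- The focal map `ν + c f`. -/
def focalMap {X : Type*} (f ν : X → Amb n) (c : ℝ) (y : X) : Amb n := ν y + c • f y

namespace IsLocalIsoparametric

variable {U : Set E} {f ν : E → Amb n} {κ : Fin n → ℝ} {κ₁ κ₂ : ℝ}

theorem differentiableAt (h : IsLocalIsoparametric U f ν κ) {y : E} (hy : y ∈ U) :
    DifferentiableAt ℝ f y :=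
  (h.smooth.contDiffAt (h.isOpen.mem_nhds hy)).differentiableAt (by simp)

theorem differentiableAt_normal (h : IsLocalIsoparametric U f ν κ) {y : E} (hy : y ∈ U) :
    DifferentiableAt ℝ ν y :=
  (h.smooth_normal.contDiffAt (h.isOpen.mem_nhds hy)).differentiableAt (by simp)

theorem contDiffAt_focalMap (h : IsLocalIsoparametric U f ν κ) (c : ℝ) {y : E} (hy : y ∈ U) :
    ContDiffAt ℝ ∞ (focalMap f ν c) y :=
  (h.smooth_normal.contDiffAt (h.isOpen.mem_nhds hy)).add
    ((h.smooth.contDiffAt (h.isOpen.mem_nhds hy)).const_smul c)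

theorem contDiffAt_fderiv_focalMap (h : IsLocalIsoparametric U f ν κ) (c : ℝ) {y : E}
    (hy : y ∈ U) : ContDiffAt ℝ ∞ (fderiv ℝ (focalMap f ν c)) y :=
  (h.contDiffAt_focalMap c hy).fderiv_right (by simp)

theorem contDiffAt_fderiv_fderiv_focalMap (h : IsLocalIsoparametric U f ν κ) (c : ℝ) {y : E}
    (hy : y ∈ U) : ContDiffAt ℝ ∞ (fderiv ℝ (fderiv ℝ (focalMap f ν c))) y :=
  (h.contDiffAt_fderiv_focalMap c hy).fderiv_right (by simp)

theorem fderiv_focalMap (h : IsLocalIsoparametric U f ν κ) (c : ℝ) {y : E} (hy : y ∈ U) (v : E) :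
    fderiv ℝ (focalMap f ν c) y v = fderiv ℝ ν y v + c • fderiv ℝ f y v := by
  have := (h.differentiableAt_normal hy).hasFDerivAt.add
    ((h.differentiableAt hy).hasFDerivAt.const_smul c)
  have h2 : fderiv ℝ (focalMap f ν c) y = _ := this.fderiv
  rw [h2]
  simp

theorem fderiv_fderiv_symm (h : IsLocalIsoparametric U f ν κ) (c : ℝ) {y : E} (hy : y ∈ U) (i k : E) :
    fderiv ℝ (fderiv ℝ (focalMap f ν c)) y i k = fderiv ℝ (fderiv ℝ (focalMap f ν c)) y k i :=
  (h.contDiffAt_focalMap c hy).isSymmSndFDerivAt (by simp [ENat.LEInfty.out]) i k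

theorem fderiv_fderiv_fderiv_symm (h : IsLocalIsoparametric U f ν κ) (c : ℝ) {y : E} (hy : y ∈ U) (i k : E) :
    fderiv ℝ (fderiv ℝ (fderiv ℝ (focalMap f ν c))) y i k =
      fderiv ℝ (fderiv ℝ (fderiv ℝ (focalMap f ν c))) y k i :=
  (h.contDiffAt_fderiv_focalMap c hy).isSymmSndFDerivAt (by simp [ENat.LEInfty.out]) i k

variable [FiniteDimensional ℝ E]

theorem inner_fderiv_focalMap (h : IsLocalIsoparametric U f ν κ) (hE : finrank ℝ E = n)
    (hκ : ∀ i, κ i = κ₁ ∨ κ i = κ₂) {y : E} (hy : y ∈ U) (v w : E) :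
    inner ℝ (fderiv ℝ (focalMap f ν κ₁) y v) (fderiv ℝ (focalMap f ν κ₂) y w) = 0 := by
  obtain ⟨e, he⟩ := h.exists_frame y hy
  rw [h.fderiv_focalMap _ hy, h.fderiv_focalMap _ hy]
  exact he.inner_focal_eq_zero hE hκ v w

/-- The values of each focal map are orthogonal to the image of each differential. -/
theorem inner_focalMap_fderiv (h : IsLocalIsoparametric U f ν κ) (hE : finrank ℝ E = n)
    (c d : ℝ) {y : E} (hy : y ∈ U) (w : E) :
    inner ℝ (focalMap f ν c y) (fderiv ℝ (focalMap f ν d) y w) = 0 := by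
  obtain ⟨e, he⟩ := h.exists_frame y hy
  rw [h.fderiv_focalMap _ hy, focalMap]
  have h1 := he.inner_f_apply hE w
  have h2 := he.inner_ν_apply hE w
  have h3 := he.inner_f_normal hE w
  have h4 := he.inner_ν_normal hE w
  simp only [ContinuousLinearMap.coe_coe] at h1 h2 h3 h4
  simp only [inner_add_left, inner_add_right, inner_smul_left, inner_smul_right, h1, h2, h3, h4]
  simp

/-- The consequence of the Codazzi equation that is used below: the second fundamental form of
one focal map is orthogonal to the image of the differential of the other. -/
theorem inner_snd_fderiv_eq_zero (h : IsLocalIsoparametric U f ν κ) (hE : finrank ℝ E = n)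
    (hκ : ∀ i, κ i = κ₁ ∨ κ i = κ₂) {y : E} (hy : y ∈ U) (i k j : E) :
    inner ℝ (fderiv ℝ (fderiv ℝ (focalMap f ν κ₁)) y i k)
      (fderiv ℝ (focalMap f ν κ₂) y j) = 0 := by
  have hp := (h.contDiffAt_fderiv_focalMap κ₁ hy).differentiableAt (by simp)
  have hq := (h.contDiffAt_fderiv_focalMap κ₂ hy).differentiableAt (by simp)
  have key : ∀ k i j : E, inner ℝ (fderiv ℝ (fderiv ℝ (focalMap f ν κ₁)) y k i)
      (fderiv ℝ (focalMap f ν κ₂) y j) + inner ℝ (fderiv ℝ (focalMap f ν κ₁) y i)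
      (fderiv ℝ (fderiv ℝ (focalMap f ν κ₂)) y k j) = 0 := by
    intro k i j
    have := inner_fderiv_add_inner_fderiv_eq_zero (c := 0)
      (u := fun z => fderiv ℝ (focalMap f ν κ₁) z i) (v := fun z => fderiv ℝ (focalMap f ν κ₂) z j)
      (hp.clm_apply (differentiableAt_const i)) (hq.clm_apply (differentiableAt_const j))
      (by filter_upwards [h.isOpen.mem_nhds hy] with z hz
          exact h.inner_fderiv_focalMap hE hκ hz i j) k
    rwa [fderiv_clm_apply_const hp, fderiv_clm_apply_const hq] at this
  -- The other term in `key` is symmetric in `k` and `j`, so this one is too.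
  have swap : ∀ k i j : E, inner ℝ (fderiv ℝ (fderiv ℝ (focalMap f ν κ₁)) y k i)
      (fderiv ℝ (focalMap f ν κ₂) y j) = inner ℝ (fderiv ℝ (fderiv ℝ (focalMap f ν κ₁)) y j i)
      (fderiv ℝ (focalMap f ν κ₂) y k) := by
    intro k i j
    have h1 := key k i j
    have h2 := key j i k
    rw [h.fderiv_fderiv_symm κ₂ hy] at h2
    linarith
  obtain ⟨e, he⟩ := h.exists_frame y hy
  -- The κ₂-part of `j` is killed by `dq`. For the κ₁-part, `swap` and the symmetry of `D²p` move
  -- `j₁` into the position where `key` leaves only a term containing `dp j₁ = 0`.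
  obtain ⟨j₁, j₂, rfl, h1, h2⟩ := he.exists_add hE hκ j
  replace h1 : fderiv ℝ (focalMap f ν κ₁) y j₁ = 0 := by rw [h.fderiv_focalMap _ hy]; exact h1
  replace h2 : fderiv ℝ (focalMap f ν κ₂) y j₂ = 0 := by rw [h.fderiv_focalMap _ hy]; exact h2
  rw [map_add, h2, add_zero, swap, h.fderiv_fderiv_symm κ₁ hy]
  have := key k j₁ i
  rwa [h1, inner_zero_left, add_zero] at this

/-- The normal parts of the second fundamental form of the focal maps. -/
theorem inner_snd_focalMap (h : IsLocalIsoparametric U f ν κ) (hE : finrank ℝ E = n)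
    (c d : ℝ) {y : E} (hy : y ∈ U) (i k : E) :
    inner ℝ (focalMap f ν c y) (fderiv ℝ (fderiv ℝ (focalMap f ν d)) y k i) =
      -inner ℝ (fderiv ℝ (focalMap f ν c) y k) (fderiv ℝ (focalMap f ν d) y i) := by
  have hp := (h.contDiffAt_focalMap c hy).differentiableAt (by simp)
  have hq := (h.contDiffAt_fderiv_focalMap d hy).differentiableAt (by simp)
  have := inner_fderiv_add_inner_fderiv_eq_zero (c := 0)
      (v := fun z => fderiv ℝ (focalMap f ν d) z i) hp
      (hq.clm_apply (differentiableAt_const i))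
      (by filter_upwards [h.isOpen.mem_nhds hy] with z hz
          exact h.inner_focalMap_fderiv hE c d hz i) k
  rw [fderiv_clm_apply_const hq] at this
  linarith

/-- Cartan's identity for two principal curvatures. -/
theorem mul_eq_neg_one (h : IsLocalIsoparametric U f ν κ) (hE : finrank ℝ E = n)
    (hκ : ∀ i, κ i = κ₁ ∨ κ i = κ₂) (hne : κ₁ ≠ κ₂) {i₁ i₂ : Fin n} (h₁ : κ i₁ = κ₁)
    (h₂ : κ i₂ = κ₂) {y : E} (hy : y ∈ U) : κ₁ * κ₂ = -1 := by
  have hκ' : ∀ i, κ i = κ₂ ∨ κ i = κ₁ := fun i => (hκ i).symm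
  have hne' : κ₁ - κ₂ ≠ 0 := sub_ne_zero.2 hne
  have hp := (h.contDiffAt_fderiv_fderiv_focalMap κ₁ hy).differentiableAt (by simp)
  have hq := (h.contDiffAt_fderiv_focalMap κ₂ hy).differentiableAt (by simp)
  have key : ∀ r j k m : E, inner ℝ (fderiv ℝ (fderiv ℝ (fderiv ℝ (focalMap f ν κ₁))) y r j k)
      (fderiv ℝ (focalMap f ν κ₂) y m) + inner ℝ (fderiv ℝ (fderiv ℝ (focalMap f ν κ₁)) y j k)
      (fderiv ℝ (fderiv ℝ (focalMap f ν κ₂)) y r m) = 0 := by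
    intro r j k m
    have hp1 : DifferentiableAt ℝ (fun z => fderiv ℝ (fderiv ℝ (focalMap f ν κ₁)) z j) y :=
      hp.clm_apply (differentiableAt_const j)
    have := inner_fderiv_add_inner_fderiv_eq_zero (c := 0)
      (u := fun z => fderiv ℝ (fderiv ℝ (focalMap f ν κ₁)) z j k)
      (v := fun z => fderiv ℝ (focalMap f ν κ₂) z m)
      (hp1.clm_apply (differentiableAt_const k)) (hq.clm_apply (differentiableAt_const m))
      (by filter_upwards [h.isOpen.mem_nhds hy] with z hz
          exact h.inner_snd_fderiv_eq_zero hE hκ hz j k m) r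
    rwa [fderiv_clm_apply_const hp1, fderiv_clm_apply_const hp, fderiv_clm_apply_const hq] at this
  obtain ⟨e, he⟩ := h.exists_frame y hy
  set X := e i₂ with hX
  set Y := e i₁ with hY
  -- Symmetry of the third derivative of `p` in its first two arguments, read through the
  -- differentiated Codazzi relation `key`. Here `X` is a κ₂-direction and `Y` a κ₁-direction.
  have swap : inner ℝ (fderiv ℝ (fderiv ℝ (focalMap f ν κ₁)) y X X)
      (fderiv ℝ (fderiv ℝ (focalMap f ν κ₂)) y Y Y) =
      inner ℝ (fderiv ℝ (fderiv ℝ (focalMap f ν κ₁)) y Y X)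
      (fderiv ℝ (fderiv ℝ (focalMap f ν κ₂)) y X Y) := by
    have h1 := key Y X X Y
    have h2 := key X Y X Y
    rw [h.fderiv_fderiv_fderiv_symm κ₁ hy] at h2
    linarith
  have hA : ∀ c i, fderiv ℝ (focalMap f ν c) y (e i) = (c - κ i) • fderiv ℝ f y (e i) := by
    intro c i
    rw [h.fderiv_focalMap c hy]
    exact he.add_smul_apply c i
  have hpY : fderiv ℝ (focalMap f ν κ₁) y Y = 0 := by rw [hY, hA, h₁, sub_self, zero_smul]
  have hqX : fderiv ℝ (focalMap f ν κ₂) y X = 0 := by rw [hX, hA, h₂, sub_self, zero_smul]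
  have hpX : fderiv ℝ (focalMap f ν κ₁) y X = (κ₁ - κ₂) • fderiv ℝ f y X := by rw [hX, hA, h₂]
  have hqY : fderiv ℝ (focalMap f ν κ₂) y Y = (κ₂ - κ₁) • fderiv ℝ f y Y := by rw [hY, hA, h₁]
  -- the tangential parts of the second fundamental forms are orthogonal
  have htan : ∀ a b c d, ∀ i,
      inner ℝ (fderiv ℝ (fderiv ℝ (focalMap f ν κ₁)) y a b) (fderiv ℝ f y (e i)) *
      inner ℝ (fderiv ℝ f y (e i)) (fderiv ℝ (fderiv ℝ (focalMap f ν κ₂)) y c d) = 0 := by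
    intro a b c d i
    rcases hκ i with hi | hi
    · have := h.inner_snd_fderiv_eq_zero hE hκ hy a b (e i)
      rw [hA, hi, inner_smul_right] at this
      rw [(mul_eq_zero.1 this).resolve_left (sub_ne_zero.2 hne.symm), zero_mul]
    · have := h.inner_snd_fderiv_eq_zero hE hκ' hy c d (e i)
      rw [hA, hi, inner_smul_right] at this
      rw [real_inner_comm _ (fderiv ℝ f y (e i)), (mul_eq_zero.1 this).resolve_left hne', mul_zero]
  have hpars : ∀ a b c d,
      inner ℝ (fderiv ℝ (fderiv ℝ (focalMap f ν κ₁)) y a b)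
        (fderiv ℝ (fderiv ℝ (focalMap f ν κ₂)) y c d) =
      inner ℝ (f y) (fderiv ℝ (fderiv ℝ (focalMap f ν κ₁)) y a b) *
        inner ℝ (f y) (fderiv ℝ (fderiv ℝ (focalMap f ν κ₂)) y c d) +
      inner ℝ (ν y) (fderiv ℝ (fderiv ℝ (focalMap f ν κ₁)) y a b) *
        inner ℝ (ν y) (fderiv ℝ (fderiv ℝ (focalMap f ν κ₂)) y c d) := by
    intro a b c d
    rw [he.inner_eq_sum]
    simp only [ContinuousLinearMap.coe_coe]
    rw [Finset.sum_eq_zero (fun i _ => htan a b c d i)]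
    rw [add_zero, real_inner_comm (f y), real_inner_comm (ν y)]
  rw [hpars, hpars] at swap
  have hunit : ∀ i, inner ℝ (fderiv ℝ f y (e i)) (fderiv ℝ f y (e i)) = (1 : ℝ) := fun i => by
    simpa using he.orthonormal i i
  -- Pairing each second derivative with both `p` and `q` gives a linear system for its components
  -- along `f` and `ν`, which is solvable since `κ₁ ≠ κ₂`.
  have e1 := h.inner_snd_focalMap hE κ₁ κ₁ hy X X
  have e2 := h.inner_snd_focalMap hE κ₂ κ₁ hy X X
  have e3 := h.inner_snd_focalMap hE κ₁ κ₂ hy Y Y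
  have e4 := h.inner_snd_focalMap hE κ₂ κ₂ hy Y Y
  have e5 := h.inner_snd_focalMap hE κ₁ κ₁ hy X Y
  have e6 := h.inner_snd_focalMap hE κ₂ κ₁ hy X Y
  rw [hpX, inner_smul_left, inner_smul_right, hX, hunit] at e1
  rw [hqX, inner_zero_left, neg_zero] at e2
  rw [hpY, inner_zero_left, neg_zero] at e3
  rw [hqY, inner_smul_left, inner_smul_right, hY, hunit] at e4
  rw [hpY, inner_zero_left, neg_zero] at e5
  rw [real_inner_comm (fderiv ℝ (focalMap f ν κ₁) y X), h.inner_fderiv_focalMap hE hκ hy,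
    neg_zero] at e6
  simp only [focalMap, inner_add_left, inner_smul_left, RCLike.conj_to_real] at e1 e2 e3 e4 e5 e6
  simp only [← hX, ← hY] at e1 e2 e3 e4 e5 e6
  generalize inner ℝ (f y) (fderiv ℝ (fderiv ℝ (focalMap f ν κ₁)) y X X) = a at *
  generalize inner ℝ (ν y) (fderiv ℝ (fderiv ℝ (focalMap f ν κ₁)) y X X) = b at *
  generalize inner ℝ (f y) (fderiv ℝ (fderiv ℝ (focalMap f ν κ₂)) y Y Y) = a' at *
  generalize inner ℝ (ν y) (fderiv ℝ (fderiv ℝ (focalMap f ν κ₂)) y Y Y) = b' at *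
  generalize inner ℝ (f y) (fderiv ℝ (fderiv ℝ (focalMap f ν κ₁)) y Y X) = a'' at *
  generalize inner ℝ (ν y) (fderiv ℝ (fderiv ℝ (focalMap f ν κ₁)) y Y X) = b'' at *
  have ha'' : a'' = 0 := mul_left_cancel₀ hne' (by linear_combination e5 - e6)
  have hb'' : b'' = 0 := by rw [ha''] at e5; linarith
  have ha : a = -(κ₁ - κ₂) := mul_left_cancel₀ hne' (by linear_combination e1 - e2)
  have hb : b = κ₂ * (κ₁ - κ₂) := by rw [ha] at e2; linarith
  have ha' : a' = κ₁ - κ₂ := mul_left_cancel₀ hne' (by linear_combination e3 - e4)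
  have hb' : b' = -κ₁ * (κ₁ - κ₂) := by rw [ha'] at e3; linarith
  rw [ha'', hb'', ha, hb, ha', hb'] at swap
  -- The mixed side of `swap` is zero and the other side equals `-(1 + κ₁ κ₂)(κ₁ - κ₂)²`.
  refine mul_left_cancel₀ (pow_ne_zero 2 hne') ?_
  linear_combination -swap

end IsLocalIsoparametric
end LocalGeometry

/-! ### Local constancy of the space spanned by a focal map and its differential. -/

section FocalSpan

/-- An injective linear map in finite dimension is bounded below. A perturbation of norm at most `1
/ (2K)` costs half of that bound, which explains the constant `2K`. -/
theorem eventually_norm_le_mul_norm_apply {E V : Type*} [NormedAddCommGroup E] [NormedSpace ℝ E]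
    [FiniteDimensional ℝ E] [NormedAddCommGroup V] [NormedSpace ℝ V] {L : E → E →L[ℝ] V} {y₀ : E}
    (hL : ContinuousAt L y₀) (hinj : Function.Injective (L y₀)) :
    ∃ C > 0, ∀ᶠ y in 𝓝 y₀, ∀ X, ‖X‖ ≤ C * ‖L y X‖ := by
  obtain ⟨K, hK, hanti⟩ := LinearMap.exists_antilipschitzWith (L y₀ : E →ₗ[ℝ] V)
    (LinearMap.ker_eq_bot.2 hinj)
  have hK' : (0 : ℝ) < K := hK
  refine ⟨2 * K, by positivity, ?_⟩
  have hε : (0 : ℝ) < 1 / (2 * K) := by positivity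
  filter_upwards [Metric.continuousAt_iff'.1 hL _ hε] with y hy X
  have h1 : ‖X‖ ≤ K * ‖L y₀ X‖ := by simpa using hanti.le_mul_dist X 0
  have h2 : ‖L y₀ X‖ ≤ ‖L y X‖ + 1 / (2 * K) * ‖X‖ := by
    have h3 : ‖(L y - L y₀) X‖ ≤ 1 / (2 * K) * ‖X‖ :=
      ContinuousLinearMap.le_of_opNorm_le _ (by rw [← dist_eq_norm]; exact hy.le) X
    have h4 : L y₀ X = L y X - (L y - L y₀) X := by simp
    calc ‖L y₀ X‖ = ‖L y X - (L y - L y₀) X‖ := by rw [← h4]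
      _ ≤ ‖L y X‖ + ‖(L y - L y₀) X‖ := norm_sub_le _ _
      _ ≤ _ := by gcongr
  have h5 : K * (1 / (2 * K) * ‖X‖) = ‖X‖ / 2 := by field_simp
  nlinarith [mul_le_mul_of_nonneg_left h2 hK'.le]

theorem exists_eventually_norm_le {X V : Type*} [TopologicalSpace X] [NormedAddCommGroup V]
    {L : X → V} {y₀ : X} (hL : ContinuousAt L y₀) : ∃ D > 0, ∀ᶠ y in 𝓝 y₀, ‖L y‖ ≤ D :=
  ⟨‖L y₀‖ + 1, by positivity, (hL.norm.eventually_lt_const (lt_add_one _)).mono fun _ => le_of_lt⟩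

variable {n : ℕ} {E : Type*} [NormedAddCommGroup E] [NormedSpace ℝ E]

namespace IsLocalIsoparametric

variable {U : Set E} {f ν : E → Amb n} {κ : Fin n → ℝ} {κ₁ κ₂ : ℝ}

theorem norm_focalMap_sq (h : IsLocalIsoparametric U f ν κ) (c : ℝ) {y : E} (hy : y ∈ U) :
    ‖focalMap f ν c y‖ ^ 2 = 1 + c ^ 2 := by
  obtain ⟨e, he⟩ := h.exists_frame y hy
  rw [focalMap, norm_add_sq_real, norm_smul, he.norm_f, he.norm_ν, inner_smul_right,
    real_inner_comm, he.inner_f_ν]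
  simp

variable [FiniteDimensional ℝ E]

/-- `D²p` is orthogonal to `im dq` by Codazzi and to `q` by differentiating `⟨q, dp⟩ = 0`, so it
lies in `span p + im dp`. Taking `Y` in the κ₂-eigenspace makes it controllable although `dp` itself
is not injective. -/
theorem exists_eq_focal (h : IsLocalIsoparametric U f ν κ) (hE : finrank ℝ E = n)
    (hκ : ∀ i, κ i = κ₁ ∨ κ i = κ₂) (hne : κ₁ ≠ κ₂) (hκκ : κ₁ * κ₂ = -1) {y : E} (hy : y ∈ U)
    (i k : E) : ∃ Y, fderiv ℝ (focalMap f ν κ₁) y Y = (κ₁ - κ₂) • fderiv ℝ f y Y ∧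
      fderiv ℝ (fderiv ℝ (focalMap f ν κ₁)) y i k =
        (inner ℝ (focalMap f ν κ₁ y) (fderiv ℝ (fderiv ℝ (focalMap f ν κ₁)) y i k) /
          (1 + κ₁ ^ 2)) • focalMap f ν κ₁ y + fderiv ℝ (focalMap f ν κ₁) y Y := by
  obtain ⟨e, he⟩ := h.exists_frame y hy
  have h1 : inner ℝ (focalMap f ν κ₂ y) (fderiv ℝ (fderiv ℝ (focalMap f ν κ₁)) y i k) = 0 := by
    rw [h.inner_snd_focalMap hE κ₂ κ₁ hy, real_inner_comm (fderiv ℝ (focalMap f ν κ₁) y k),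
      h.inner_fderiv_focalMap hE hκ hy, neg_zero]
  have h2 : ∀ v, inner ℝ (fderiv ℝ ν y v + κ₂ • fderiv ℝ f y v)
      (fderiv ℝ (fderiv ℝ (focalMap f ν κ₁)) y i k) = 0 := by
    intro v
    rw [← h.fderiv_focalMap κ₂ hy, real_inner_comm]
    exact h.inner_snd_fderiv_eq_zero hE hκ hy i k v
  obtain ⟨Y, hY, hz⟩ := he.exists_eq_focal hκ hne hκκ h1 h2
  refine ⟨Y, ?_, ?_⟩
  · rw [h.fderiv_focalMap κ₁ hy]
    simp only [ContinuousLinearMap.coe_coe] at hY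
    rw [eq_neg_of_add_eq_zero_left hY]
    module
  · rw [h.fderiv_focalMap κ₁ hy]
    exact hz

/-- Uniform estimate of the second derivative of `⟨w, ν + κ₁ f⟩` by its `1`-jet. -/
theorem exists_norm_comp_snd_le (h : IsLocalIsoparametric U f ν κ) (hE : finrank ℝ E = n)
    (hκ : ∀ i, κ i = κ₁ ∨ κ i = κ₂) (hne : κ₁ ≠ κ₂) (hκκ : κ₁ * κ₂ = -1) {y₀ : E} (hy₀ : y₀ ∈ U) :
    ∃ K ≥ 0, ∀ᶠ y in 𝓝 y₀, y ∈ U ∧ ∀ (w : Amb n) (k : E),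
      ‖(innerSL ℝ w).comp (fderiv ℝ (fderiv ℝ (focalMap f ν κ₁)) y k)‖ ≤ K * ‖k‖ *
        ‖((inner ℝ w (focalMap f ν κ₁ y) : ℝ),
          (innerSL ℝ w).comp (fderiv ℝ (focalMap f ν κ₁) y))‖ := by
  obtain ⟨e₀, he₀⟩ := h.exists_frame y₀ hy₀
  have hc : ContinuousAt (fderiv ℝ f) y₀ :=
    ((h.smooth.contDiffAt (h.isOpen.mem_nhds hy₀)).fderiv_right (m := ∞) (by simp)).continuousAt
  obtain ⟨C, hC, hCy⟩ := eventually_norm_le_mul_norm_apply hc (he₀.injective hE)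
  obtain ⟨D, hD, hDy⟩ :=
    exists_eventually_norm_le (h.contDiffAt_fderiv_fderiv_focalMap κ₁ hy₀).continuousAt
  have hne' : |κ₁ - κ₂| ≠ 0 := abs_ne_zero.2 (sub_ne_zero.2 hne)
  -- `D` bounds `D²p`; the `1` comes from the coefficient of `p`, and the other summand from the
  -- bound on `Y` in terms of `ζ`, obtained by inverting `df` at cost `C`.
  refine ⟨(1 + C * (2 + κ₁ ^ 2) / |κ₁ - κ₂|) * D, by positivity, ?_⟩
  filter_upwards [h.isOpen.mem_nhds hy₀, hCy, hDy] with y hy hCy hDy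
  refine ⟨hy, fun w k => ?_⟩
  set x : ℝ × (E →L[ℝ] ℝ) := ((inner ℝ w (focalMap f ν κ₁ y) : ℝ),
    (innerSL ℝ w).comp (fderiv ℝ (focalMap f ν κ₁) y))
  set J := ‖x‖
  refine ContinuousLinearMap.opNorm_le_bound _ (by positivity) fun X => ?_
  obtain ⟨Y, hY, hζ⟩ := h.exists_eq_focal hE hκ hne hκκ hy k X
  rw [ContinuousLinearMap.comp_apply, innerSL_apply_apply]
  have hn : ‖fderiv ℝ (fderiv ℝ (focalMap f ν κ₁)) y k X‖ ≤ D * ‖k‖ * ‖X‖ :=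
    (ContinuousLinearMap.le_opNorm₂ _ _ _).trans (by gcongr)
  set ζ := fderiv ℝ (fderiv ℝ (focalMap f ν κ₁)) y k X
  set α := (inner ℝ (focalMap f ν κ₁ y) ζ : ℝ) / (1 + κ₁ ^ 2) with hα
  have hp2 := h.norm_focalMap_sq κ₁ hy
  have hpn : ‖focalMap f ν κ₁ y‖ ≤ 1 + κ₁ ^ 2 := by nlinarith [sq_nonneg κ₁]
  have hpos : 0 < 1 + κ₁ ^ 2 := by positivity
  have hα' : |α| ≤ ‖ζ‖ := by
    rw [hα, abs_div, abs_of_pos hpos, div_le_iff₀ hpos, mul_comm]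
    exact (abs_real_inner_le_norm _ _).trans (by gcongr)
  have hpY : ‖fderiv ℝ (focalMap f ν κ₁) y Y‖ ≤ (2 + κ₁ ^ 2) * ‖ζ‖ := by
    have : fderiv ℝ (focalMap f ν κ₁) y Y = ζ - α • focalMap f ν κ₁ y := by
      rw [eq_sub_iff_add_eq', ← hζ]
    rw [this]
    calc _ ≤ ‖ζ‖ + ‖α • focalMap f ν κ₁ y‖ := norm_sub_le _ _
      _ = ‖ζ‖ + |α| * ‖focalMap f ν κ₁ y‖ := by rw [norm_smul, Real.norm_eq_abs]
      _ ≤ ‖ζ‖ + ‖ζ‖ * (1 + κ₁ ^ 2) := by gcongr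
      _ = _ := by ring
  have hYn : ‖Y‖ ≤ C * (2 + κ₁ ^ 2) / |κ₁ - κ₂| * ‖ζ‖ := by
    rw [hY, norm_smul, Real.norm_eq_abs] at hpY
    calc ‖Y‖ ≤ C * ‖fderiv ℝ f y Y‖ := hCy Y
      _ = C / |κ₁ - κ₂| * (|κ₁ - κ₂| * ‖fderiv ℝ f y Y‖) := by field_simp
      _ ≤ C / |κ₁ - κ₂| * ((2 + κ₁ ^ 2) * ‖ζ‖) := by gcongr
      _ = _ := by ring
  have h1 : ‖(inner ℝ w (focalMap f ν κ₁ y) : ℝ)‖ ≤ J := norm_fst_le x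
  have h2 : ‖(inner ℝ w (fderiv ℝ (focalMap f ν κ₁) y Y) : ℝ)‖ ≤ J * ‖Y‖ := by
    have := ((innerSL ℝ w).comp (fderiv ℝ (focalMap f ν κ₁) y)).le_opNorm Y
    rw [ContinuousLinearMap.comp_apply, innerSL_apply_apply] at this
    refine this.trans (mul_le_mul_of_nonneg_right ?_ (norm_nonneg _))
    exact norm_snd_le x
  have hJ0 : 0 ≤ J := norm_nonneg _
  calc ‖(inner ℝ w ζ : ℝ)‖ = ‖α * inner ℝ w (focalMap f ν κ₁ y) +
        inner ℝ w (fderiv ℝ (focalMap f ν κ₁) y Y)‖ := by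
        rw [hζ, inner_add_right, inner_smul_right]
    _ ≤ |α| * ‖(inner ℝ w (focalMap f ν κ₁ y) : ℝ)‖ +
        ‖(inner ℝ w (fderiv ℝ (focalMap f ν κ₁) y Y) : ℝ)‖ := by
        refine (norm_add_le _ _).trans ?_
        rw [norm_mul, Real.norm_eq_abs α]
    _ ≤ ‖ζ‖ * J + J * (C * (2 + κ₁ ^ 2) / |κ₁ - κ₂| * ‖ζ‖) := by
        gcongr
        exact h2.trans (by gcongr)
    _ = (1 + C * (2 + κ₁ ^ 2) / |κ₁ - κ₂|) * J * ‖ζ‖ := by ring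
    _ ≤ (1 + C * (2 + κ₁ ^ 2) / |κ₁ - κ₂|) * J * (D * ‖k‖ * ‖X‖) := by gcongr
    _ = _ := by ring

/-- The span of `ν + κ₁ f` and of the image of its differential is locally constant. -/
theorem eventually_orthogonal_focal (h : IsLocalIsoparametric U f ν κ) (hE : finrank ℝ E = n)
    (hκ : ∀ i, κ i = κ₁ ∨ κ i = κ₂) (hne : κ₁ ≠ κ₂) (hκκ : κ₁ * κ₂ = -1) {y₀ : E} (hy₀ : y₀ ∈ U) :
    ∃ W ∈ 𝓝 y₀, W ⊆ U ∧ ∀ w : Amb n, ∀ y ∈ W, ∀ z ∈ W,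
      inner ℝ w (focalMap f ν κ₁ y) = 0 → (∀ v, inner ℝ w (fderiv ℝ (focalMap f ν κ₁) y v) = 0) →
      inner ℝ w (focalMap f ν κ₁ z) = 0 ∧ ∀ v, inner ℝ w (fderiv ℝ (focalMap f ν κ₁) z v) = 0 := by
  obtain ⟨K, hK, hKy⟩ := h.exists_norm_comp_snd_le hE hκ hne hκκ hy₀
  obtain ⟨r, hr, hball⟩ := Metric.eventually_nhds_iff_ball.1 hKy
  refine ⟨Metric.ball y₀ r, Metric.ball_mem_nhds _ hr, fun y hy => (hball y hy).1, ?_⟩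
  intro w y hy z hz hwy hwy'
  have hγ : ∀ s ∈ Icc (0 : ℝ) 1, y + s • (z - y) ∈ Metric.ball y₀ r := fun s hs =>
    (convex_ball y₀ r).add_smul_sub_mem hy hz hs
  -- The 1-jet of `⟨w, p⟩` along the segment from `y` to `z`. It vanishes at `s = 0` and satisfies
  -- `‖u'‖ ≤ const · ‖u‖`, so Grönwall forces it to vanish at `s = 1`.
  let u : ℝ → ℝ × (E →L[ℝ] ℝ) := fun s => (inner ℝ w (focalMap f ν κ₁ (y + s • (z - y))),
    (innerSL ℝ w).comp (fderiv ℝ (focalMap f ν κ₁) (y + s • (z - y))))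
  let u' : ℝ → ℝ × (E →L[ℝ] ℝ) := fun s =>
    (inner ℝ w (fderiv ℝ (focalMap f ν κ₁) (y + s • (z - y)) (z - y)),
      (innerSL ℝ w).comp (fderiv ℝ (fderiv ℝ (focalMap f ν κ₁)) (y + s • (z - y)) (z - y)))
  have hder : ∀ s ∈ Icc (0 : ℝ) 1, HasDerivAt u (u' s) s := by
    intro s hs
    have hU := (hball _ (hγ s hs)).1
    have hl : HasDerivAt (fun s : ℝ => y + s • (z - y)) (z - y) s := by
      simpa using ((hasDerivAt_id s).smul_const (z - y)).const_add y
    have hp := ((h.contDiffAt_focalMap κ₁ hU).differentiableAt (by simp)).hasFDerivAt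
    have hp' := ((h.contDiffAt_fderiv_focalMap κ₁ hU).differentiableAt (by simp)).hasFDerivAt
    have h1 := (innerSL ℝ w).hasFDerivAt.comp_hasDerivAt s (hp.comp_hasDerivAt s hl)
    have h2 := (ContinuousLinearMap.compL ℝ E (Amb n) ℝ
      (innerSL ℝ w)).hasFDerivAt.comp_hasDerivAt s (hp'.comp_hasDerivAt s hl)
    exact h1.prodMk h2
  have hu0 : u 0 = 0 := by
    refine Prod.ext ?_ (ContinuousLinearMap.ext fun v => ?_)
    · simpa [u] using hwy
    · simpa [u] using hwy' v
  have hbound : ∀ s ∈ Ico (0 : ℝ) 1, ‖u' s‖ ≤ ((K + 1) * ‖z - y‖) * ‖u s‖ := by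
    intro s hs
    have hs' : s ∈ Icc (0 : ℝ) 1 := ⟨hs.1, hs.2.le⟩
    have h2 := (hball _ (hγ s hs')).2 w (z - y)
    have h3 : ‖(u' s).1‖ ≤ ‖u s‖ * ‖z - y‖ := by
      have := ((innerSL ℝ w).comp (fderiv ℝ (focalMap f ν κ₁) (y + s • (z - y)))).le_opNorm (z - y)
      exact this.trans (mul_le_mul_of_nonneg_right (norm_snd_le (u s)) (norm_nonneg _))
    refine (Prod.norm_def _).trans_le (max_le ?_ ?_)
    · nlinarith [mul_nonneg hK (mul_nonneg (norm_nonneg (u s)) (norm_nonneg (z - y)))]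
    · change ‖(u' s).2‖ ≤ K * ‖z - y‖ * ‖u s‖ at h2
      nlinarith [mul_nonneg (norm_nonneg (u s)) (norm_nonneg (z - y))]
  have hu1 := eq_zero_of_abs_deriv_le_mul_abs_self_of_eq_zero_right
    (fun s hs => (hder s hs).continuousAt.continuousWithinAt)
    (fun s hs => (hder s ⟨hs.1, hs.2.le⟩).hasDerivWithinAt) hu0 hbound 1 (by simp)
  refine ⟨?_, fun v => ?_⟩
  · simpa [u] using congrArg Prod.fst hu1
  · simpa [u] using congrArg (fun L => L v) (congrArg Prod.snd hu1)

end IsLocalIsoparametric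
end FocalSpan

/-! ### Transfer from the manifold to parametrizations by charts. -/

section Charts

variable {n : ℕ} {E : Type*} [NormedAddCommGroup E] [NormedSpace ℝ E]
  {H : Type*} [TopologicalSpace H] (I : ModelWithCorners ℝ E H)
  {M : Type*} [TopologicalSpace M] [ChartedSpace H M]

/-- The interior of the domain of the inverse of the extended chart. -/
def chartInterior (x₀ : M) : Set E := interior (extChartAt I x₀).target

theorem isOpen_chartInterior (x₀ : M) : IsOpen (chartInterior I x₀) := isOpen_interior

theorem mem_chartInterior [BoundarylessManifold I M] (x₀ : M) :
    extChartAt I x₀ x₀ ∈ chartInterior I x₀ :=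
  ModelWithCorners.isInteriorPoint_iff.1 (BoundarylessManifold.isInteriorPoint' x₀)

theorem preimage_extChartAt_mem_nhds {x₀ : M} {W : Set E} (hW : W ∈ 𝓝 (extChartAt I x₀ x₀)) :
    ∀ᶠ x in 𝓝 x₀, x ∈ (extChartAt I x₀).source ∧ extChartAt I x₀ x ∈ W :=
  (extChartAt_source_mem_nhds x₀ |> Filter.Eventually.and <|
    (continuousAt_extChartAt x₀).eventually_mem hW)

theorem differential_add_smul {G₁ G₂ : M → Amb n} (h₁ : ContMDiff I 𝓘(ℝ, Amb n) ∞ G₁)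
    (h₂ : ContMDiff I 𝓘(ℝ, Amb n) ∞ G₂) (a b : ℝ) (x : M) (v : TangentSpace I x) :
    differential I (fun z => a • G₁ z + b • G₂ z) x v =
      a • differential I G₁ x v + b • differential I G₂ x v := by
  have e := (((h₁.mdifferentiable (by simp) x).hasMFDerivAt.const_smul a).add
    ((h₂.mdifferentiable (by simp) x).hasMFDerivAt.const_smul b)).mfderiv
  have e' : differential I (fun z => a • G₁ z + b • G₂ z) x = _ := e
  rw [e']
  rfl

theorem contMDiff_add_smul {G₁ G₂ : M → Amb n} (h₁ : ContMDiff I 𝓘(ℝ, Amb n) ∞ G₁)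
    (h₂ : ContMDiff I 𝓘(ℝ, Amb n) ∞ G₂) (a b : ℝ) :
    ContMDiff I 𝓘(ℝ, Amb n) ∞ (fun z => a • G₁ z + b • G₂ z) :=
  ((contDiff_const_smul a).contMDiff.comp h₁).add ((contDiff_const_smul b).contMDiff.comp h₂)

variable [IsManifold I ∞ M]

theorem contDiffOn_comp_extChartAt_symm {G : M → Amb n} (hG : ContMDiff I 𝓘(ℝ, Amb n) ∞ G)
    (x₀ : M) : ContDiffOn ℝ ∞ (G ∘ (extChartAt I x₀).symm) (chartInterior I x₀) := by
  rw [← contMDiffOn_iff_contDiffOn]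
  exact (hG.comp_contMDiffOn (contMDiffOn_extChartAt_symm x₀)).mono interior_subset

/-- Differentials in terms of a chart. -/
theorem exists_differential_eq {x₀ : M} {y : E} (hy : y ∈ chartInterior I x₀) :
    ∃ J : TangentSpace I ((extChartAt I x₀).symm y) ≃ₗ[ℝ] E, ∀ G : M → Amb n,
      ContMDiff I 𝓘(ℝ, Amb n) ∞ G → ∀ v, differential I G ((extChartAt I x₀).symm y) v =
        fderiv ℝ (G ∘ (extChartAt I x₀).symm) y (J v) := by
  have hyt : y ∈ (extChartAt I x₀).target := interior_subset hy
  have hx : (extChartAt I x₀).symm y ∈ (extChartAt I x₀).source :=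
    (extChartAt I x₀).map_target hyt
  obtain ⟨J, hJ⟩ := isInvertible_mfderiv_extChartAt (I := I) hx
  refine ⟨J.toLinearEquiv, fun G hG v => ?_⟩
  set x := (extChartAt I x₀).symm y with hxdef
  have hφx : extChartAt I x₀ x = y := (extChartAt I x₀).right_inv hyt
  have hφ : MDifferentiableAt I 𝓘(ℝ, E) (extChartAt I x₀) x :=
    mdifferentiableAt_extChartAt (by rwa [extChartAt_source] at hx)
  have hg : DifferentiableAt ℝ (G ∘ (extChartAt I x₀).symm) (extChartAt I x₀ x) := by
    rw [hφx]
    exact ((contDiffOn_comp_extChartAt_symm I hG x₀).contDiffAt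
      ((isOpen_chartInterior I x₀).mem_nhds hy)).differentiableAt (by simp)
  have heq : G =ᶠ[𝓝 x] (G ∘ (extChartAt I x₀).symm) ∘ extChartAt I x₀ := by
    filter_upwards [(isOpen_extChartAt_source x₀).mem_nhds hx] with z hz
    simp only [Function.comp_apply, (extChartAt I x₀).left_inv hz]
  have hcomp := mfderiv_comp x hg.mdifferentiableAt hφ
  rw [differential, heq.mfderiv_eq, hcomp, mfderiv_eq_fderiv, hφx, ← hJ]
  rfl

variable [BoundarylessManifold I M]

theorem exists_differential_eq_self (x : M) :
    ∃ J : TangentSpace I x ≃ₗ[ℝ] E, ∀ G : M → Amb n,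
      ContMDiff I 𝓘(ℝ, Amb n) ∞ G → ∀ v, differential I G x v =
        fderiv ℝ (G ∘ (extChartAt I x).symm) (extChartAt I x x) (J v) := by
  have := exists_differential_eq (n := n) I (mem_chartInterior I x)
  rwa [extChartAt_to_inv] at this

theorem inner_differential_add_inner_differential_eq_zero {G₁ G₂ : M → Amb n}
    (h₁ : ContMDiff I 𝓘(ℝ, Amb n) ∞ G₁) (h₂ : ContMDiff I 𝓘(ℝ, Amb n) ∞ G₂) {c : ℝ}
    (h : ∀ x, inner ℝ (G₁ x) (G₂ x) = c) (x : M) (v : TangentSpace I x) :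
    inner ℝ (differential I G₁ x v) (G₂ x) + inner ℝ (G₁ x) (differential I G₂ x v) = 0 := by
  obtain ⟨J, hJ⟩ := exists_differential_eq_self (n := n) I x
  have hd : ∀ {G : M → Amb n}, ContMDiff I 𝓘(ℝ, Amb n) ∞ G →
      DifferentiableAt ℝ (G ∘ (extChartAt I x).symm) (extChartAt I x x) := fun hG =>
    ((contDiffOn_comp_extChartAt_symm I hG x).contDiffAt
      ((isOpen_chartInterior I x).mem_nhds (mem_chartInterior I x))).differentiableAt (by simp)
  rw [hJ _ h₁, hJ _ h₂]
  have := inner_fderiv_add_inner_fderiv_eq_zero (c := c) (hd h₁) (hd h₂)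
    (Eventually.of_forall fun z => h _) (J v)
  simpa using this

variable {I}

/-- A frame of principal vectors of a hypersurface, at a point. -/
theorem HasPrincipalCurvatures.exists_frame {F N : M → Amb n}
    (hF : IsOrientedHypersurface I F N) {x : M} {κ : Fin n → ℝ}
    (h : HasPrincipalCurvatures I F N x κ) :
    ∃ e, IsPrincipalFrame (differential I F x).toLinearMap
      (differential I N x).toLinearMap (F x) (N x) κ e := by
  obtain ⟨e, he⟩ := h
  -- Differentiating `|F|² = 1`, `|N|² = 1` and `⟨F, N⟩ = 0` shows that `dF` and `dN` have no
  -- components along `F` and `N`, as Weingarten's formula requires.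
  have hFF : ∀ v, inner ℝ (F x) (differential I F x v) = 0 := fun v => by
    have := inner_differential_add_inner_differential_eq_zero I hF.smooth hF.smooth (c := 1)
      (fun x => by rw [real_inner_self_eq_norm_sq, hF.mem_sphere, one_pow]) x v
    rw [real_inner_comm (F x)] at this
    linarith
  have hNN : ∀ v, inner ℝ (N x) (differential I N x v) = 0 := fun v => by
    have := inner_differential_add_inner_differential_eq_zero I hF.smooth_normal hF.smooth_normal
      (c := 1) (fun x => by rw [real_inner_self_eq_norm_sq, hF.norm_normal, one_pow]) x v
    rw [real_inner_comm (N x)] at this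
    linarith
  have hFN : ∀ v, inner ℝ (F x) (differential I N x v) = 0 := fun v => by
    have := inner_differential_add_inner_differential_eq_zero I hF.smooth hF.smooth_normal
      (c := 0) (fun x => by rw [real_inner_comm, hF.normal_tangent_sphere]) x v
    rw [real_inner_comm (N x), hF.normal_orthogonal] at this
    linarith
  have ha : IsAdaptedFrame (differential I F x).toLinearMap (F x) (N x) e :=
    { norm_f := hF.mem_sphere x
      norm_ν := hF.norm_normal x
      inner_f_ν := by rw [real_inner_comm, hF.normal_tangent_sphere]
      inner_f := fun i => hFF (e i)
      inner_ν := fun i => hF.normal_orthogonal x (e i)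
      orthonormal := fun i j => (he i j).1 }
  exact ⟨e, ha, ha.weingarten hFN hNN fun i j => (he i j).2⟩

/-- An isoparametric hypersurface in a chart. -/
theorem IsIsoparametric.isLocalIsoparametric {F N : M → Amb n}
    (hF : IsOrientedHypersurface I F N)
    {κ : Fin n → ℝ} (h : IsIsoparametric I F N κ) (x₀ : M) :
    IsLocalIsoparametric (chartInterior I x₀) (F ∘ (extChartAt I x₀).symm)
      (N ∘ (extChartAt I x₀).symm) κ where
  isOpen := isOpen_chartInterior I x₀
  smooth := contDiffOn_comp_extChartAt_symm I hF.smooth x₀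
  smooth_normal := contDiffOn_comp_extChartAt_symm I hF.smooth_normal x₀
  exists_frame y hy := by
    obtain ⟨J, hJ⟩ := exists_differential_eq (n := n) I hy
    obtain ⟨e, he⟩ := (h ((extChartAt I x₀).symm y)).exists_frame hF
    refine ⟨fun i => J (e i), ⟨he.norm_f, he.norm_ν, he.inner_f_ν, fun i => ?_, fun i => ?_,
      fun i j => ?_⟩, fun i => ?_⟩
    · have := he.inner_f i
      rwa [ContinuousLinearMap.coe_coe, hJ _ hF.smooth] at this
    · have := he.inner_ν i
      rwa [ContinuousLinearMap.coe_coe, hJ _ hF.smooth] at this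
    · have := he.orthonormal i j
      rwa [ContinuousLinearMap.coe_coe, hJ _ hF.smooth, hJ _ hF.smooth] at this
    · have := he.weingarten i
      rwa [ContinuousLinearMap.coe_coe, ContinuousLinearMap.coe_coe, hJ _ hF.smooth,
        hJ _ hF.smooth_normal] at this

end Charts

/-! ### The focal image as an open part of a great sphere, and its embeddedness. -/

section FocalSubmanifold

theorem Submodule.finrank_span_singleton_sup {V : Type*} [NormedAddCommGroup V]
    [InnerProductSpace ℝ V] [FiniteDimensional ℝ V] {u : V} (hu : u ≠ 0) (W : Submodule ℝ V)
    (h : ∀ w ∈ W, inner ℝ u w = 0) :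
    finrank ℝ (Submodule.span ℝ {u} ⊔ W : Submodule ℝ V) = finrank ℝ W + 1 := by
  have hd : Submodule.span ℝ {u} ⊓ W = ⊥ := by
    refine (Submodule.eq_bot_iff _).2 fun w hw => ?_
    obtain ⟨c, rfl⟩ := Submodule.mem_span_singleton.1 hw.1
    have := h _ hw.2
    rw [inner_smul_right, real_inner_self_eq_norm_sq] at this
    rcases mul_eq_zero.1 this with h1 | h1
    · simp [h1]
    · exact absurd (norm_eq_zero.1 (by simpa using h1)) hu
  have := Submodule.finrank_sup_add_finrank_inf_eq (Submodule.span ℝ {u}) W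
  rw [hd, finrank_bot, finrank_span_singleton hu] at this
  omega

theorem IsAdaptedFrame.finrank_range {n : ℕ} {T : Type*} [AddCommGroup T] [Module ℝ T]
    [FiniteDimensional ℝ T] {A D : T →ₗ[ℝ] Amb n} {f ν : Amb n} {e : Fin n → T} {d : Fin n → ℝ}
    (h : IsAdaptedFrame A f ν e) (hT : finrank ℝ T = n) (hD : ∀ i, D (e i) = d i • A (e i)) :
    finrank ℝ (LinearMap.range D) = {i | d i ≠ 0}.ncard := by
  classical
  have hli : LinearIndependent ℝ (fun i : {i // d i ≠ 0} => A (e i)) :=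
    h.linearIndependent_comp.comp _ Subtype.val_injective
  have hr : LinearMap.range D = Submodule.span ℝ (range fun i : {i // d i ≠ 0} => A (e i)) := by
    refine le_antisymm ?_ (Submodule.span_le.2 ?_)
    · rintro _ ⟨v, rfl⟩
      obtain ⟨c, rfl⟩ := h.exists_sum hT v
      simp only [map_sum, map_smul, hD]
      refine Submodule.sum_mem _ fun i _ => Submodule.smul_mem _ _ ?_
      by_cases hi : d i = 0
      · simp [hi]
      · exact Submodule.smul_mem _ _ (Submodule.subset_span ⟨⟨i, hi⟩, rfl⟩)
    · rintro _ ⟨⟨i, hi⟩, rfl⟩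
      refine ⟨(d i)⁻¹ • e i, ?_⟩
      rw [map_smul, hD, smul_smul, inv_mul_cancel₀ hi, one_smul]
  rw [hr, finrank_span_eq_card hli, ← Nat.card_eq_fintype_card]
  rfl

variable {n : ℕ} {E : Type*} [NormedAddCommGroup E] [NormedSpace ℝ E] [FiniteDimensional ℝ E]
  {H : Type*} [TopologicalSpace H] {I : ModelWithCorners ℝ E H}
  {M : Type*} [TopologicalSpace M] [ChartedSpace H M] [IsManifold I ∞ M]
  [BoundarylessManifold I M]

/-- A map to the unit sphere of a subspace whose differentials are onto covers a neighbourhood of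
each of its values. -/
theorem exists_isOpen_inter_sphere_subset_range {G : M → Amb n}
    (hG : ContMDiff I 𝓘(ℝ, Amb n) ∞ G) (hG1 : ∀ x, ‖G x‖ = 1) (V : Submodule ℝ (Amb n))
    (hV : ∀ x, Submodule.span ℝ {G x} ⊔ (differential I G x).range = V) (x : M) :
    ∃ O : Set (Amb n), IsOpen O ∧ G x ∈ O ∧ ∀ z ∈ O, z ∈ V → ‖z‖ = 1 → z ∈ range G := by
  obtain ⟨J, hJ⟩ := exists_differential_eq_self (n := n) I x
  have hGV : ∀ x, G x ∈ V := fun x => by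
    rw [← hV x]
    exact Submodule.mem_sup_left (Submodule.mem_span_singleton_self _)
  set g := G ∘ (extChartAt I x).symm with hg
  set y₀ := extChartAt I x x with hy₀
  have hgy₀ : g y₀ = G x := by simp [hg, hy₀]
  have hgs : ContDiffAt ℝ ∞ g y₀ := (contDiffOn_comp_extChartAt_symm I hG x).contDiffAt
    ((isOpen_chartInterior I x).mem_nhds (mem_chartInterior I x))
  let π : Amb n →L[ℝ] V := V.orthogonalProjectionOnto
  have hπ : ∀ z (hz : z ∈ V), (π z : Amb n) = z := fun z hz =>
    congrArg Subtype.val (V.orthogonalProjectionOnto_mem_subspace_eq_self ⟨z, hz⟩)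
  -- The cone over `g`: the radial parameter supplies the direction of `G x` missing from `im dG`,
  -- so the derivative at `(y₀, 1)` is onto `V`. It is not injective in general, hence the
  -- surjective form of the inverse function theorem.
  let Ψ : E × ℝ → V := fun p => p.2 • π (g p.1)
  let L : E × ℝ →L[ℝ] V := (1 : ℝ) • π.comp ((fderiv ℝ g y₀).comp (ContinuousLinearMap.fst ℝ E ℝ)) +
    (ContinuousLinearMap.snd ℝ E ℝ).smulRight (π (g y₀))
  have hΨ : HasStrictFDerivAt Ψ L (y₀, (1 : ℝ)) :=
    (hasStrictFDerivAt_snd (𝕜 := ℝ) (p := (y₀, (1 : ℝ)))).smul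
      (π.hasStrictFDerivAt.comp (y₀, (1 : ℝ))
      ((hgs.hasStrictFDerivAt (by simp)).comp (y₀, (1 : ℝ))
        (hasStrictFDerivAt_fst (𝕜 := ℝ) (p := (y₀, (1 : ℝ))))))
  have hsurj : L.range = ⊤ := by
    refine LinearMap.range_eq_top.2 fun v => ?_
    have hv : (v : Amb n) ∈ Submodule.span ℝ {G x} ⊔ (differential I G x).range := by
      rw [hV x]; exact v.2
    obtain ⟨_, hs, _, ⟨X, rfl⟩, hsum⟩ := Submodule.mem_sup.1 hv
    obtain ⟨σ, rfl⟩ := Submodule.mem_span_singleton.1 hs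
    refine ⟨(J X, σ), ?_⟩
    have h1 : L (J X, σ) = π (σ • G x + differential I G x X) := by
      rw [hJ G hG, map_add, map_smul, ← hgy₀]
      simp [L, add_comm, hg, hy₀]
    have h2 : differential I G x X = (differential I G x).toLinearMap X := rfl
    refine h1.trans ?_
    rw [h2, hsum]
    exact Subtype.ext (hπ _ v.2)
  have hmap := hΨ.map_nhds_eq_of_surj hsurj
  have hmem : Ψ '' (chartInterior I x ×ˢ Ioi 0) ∈ 𝓝 (π (G x)) := by
    have : Ψ (y₀, 1) = π (G x) := by simp [Ψ, hgy₀]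
    rw [← this, ← hmap]
    exact image_mem_map (prod_mem_nhds ((isOpen_chartInterior I x).mem_nhds
      (mem_chartInterior I x)) (Ioi_mem_nhds one_pos))
  obtain ⟨O, hO, hOo, hxO⟩ := mem_nhds_iff.1 (π.continuous.continuousAt.preimage_mem_nhds hmem)
  refine ⟨O, hOo, hxO, fun z hzO hzV hz1 => ?_⟩
  obtain ⟨⟨y, s⟩, ⟨-, hs⟩, hys⟩ := hO hzO
  have hz : z = s • g y := by
    have := congrArg Subtype.val hys
    rw [hπ z hzV] at this
    rw [← this]
    simp only [Ψ, Submodule.coe_smul]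
    rw [hπ (g y) (hGV _)]
  -- With `s > 0` and `‖g y‖ = 1`, the radial parameter is `‖z‖`.
  have hs1 : s = 1 := by
    have h1 : ‖g y‖ = 1 := hG1 _
    rw [hz, norm_smul, h1, mul_one, Real.norm_eq_abs, abs_of_pos hs] at hz1
    exact hz1
  exact ⟨(extChartAt I x).symm y, by rw [hz, hs1, one_smul]; rfl⟩

/-- The image is open in the unit sphere of `V`, which is cut out by the projection to `Vᗮ` together
with `‖z‖² - 1`. Neither injectivity of `G` nor compactness of `M` is needed. -/
theorem isEmbeddedSubmanifold_range {G : M → Amb n} {k : ℕ}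
    (hG : ContMDiff I 𝓘(ℝ, Amb n) ∞ G) (hG1 : ∀ x, ‖G x‖ = 1) (V : Submodule ℝ (Amb n))
    (hV : ∀ x, Submodule.span ℝ {G x} ⊔ (differential I G x).range = V)
    (hk : finrank ℝ V = k + 1) : IsEmbeddedSubmanifold k (range G) := by
  have hGV : ∀ x, G x ∈ V := fun x => by
    rw [← hV x]
    exact Submodule.mem_sup_left (Submodule.mem_span_singleton_self _)
  let π : Amb n →L[ℝ] V := V.orthogonalProjectionOnto
  let ρ : Amb n →L[ℝ] Vᗮ := Vᗮ.orthogonalProjectionOnto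
  have hρV : ∀ z, ρ z = 0 ↔ z ∈ V := fun z => by
    rw [Submodule.orthogonalProjectionOnto_eq_zero_iff, Submodule.orthogonal_orthogonal]
  have hsum := V.finrank_add_finrank_orthogonal
  rw [hk, finrank_euclideanSpace_fin] at hsum
  obtain ⟨c, hc⟩ : ∃ c, c = finrank ℝ Vᗮ + 1 := ⟨_, rfl⟩
  let T : (Vᗮ × ℝ) ≃L[ℝ] EuclideanSpace ℝ (Fin c) :=
    ContinuousLinearEquiv.ofFinrankEq (by simp [hc])
  let Φ : Amb n → EuclideanSpace ℝ (Fin c) := fun z => T (ρ z, ‖z‖ ^ 2 - 1)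
  have hΦ0 : ∀ z, Φ z = 0 ↔ z ∈ V ∧ ‖z‖ = 1 := by
    intro z
    rw [← hρV]
    simp only [Φ, map_eq_zero_iff T T.injective, Prod.mk_eq_zero, sub_eq_zero]
    refine and_congr_right fun _ => ?_
    rw [pow_eq_one_iff_of_nonneg (norm_nonneg _) two_ne_zero]
  have hΦd : ∀ z, HasFDerivAt Φ (T.toContinuousLinearMap.comp
      (ρ.prod ((2 : ℕ) • innerSL ℝ z))) z := by
    intro z
    have h1 : HasFDerivAt (fun z : Amb n => ‖z‖ ^ 2 - 1) ((2 : ℕ) • innerSL ℝ z) z := by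
      simpa using ((hasStrictFDerivAt_norm_sq z).hasFDerivAt).sub_const 1
    exact T.toContinuousLinearMap.hasFDerivAt.comp z (ρ.hasFDerivAt.prodMk h1)
  refine ⟨c, by omega, ?_⟩
  rintro _ ⟨x, rfl⟩
  obtain ⟨O, hO, hxO, hOV⟩ := exists_isOpen_inter_sphere_subset_range hG hG1 V hV x
  have hπ : ∀ z (hz : z ∈ V), (π z : Amb n) = z := fun z hz =>
    congrArg Subtype.val (V.orthogonalProjectionOnto_mem_subspace_eq_self ⟨z, hz⟩)
  refine ⟨O ∩ {z | π z ≠ 0}, Φ, hO.inter (isOpen_ne_fun π.continuous continuous_const),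
    ⟨hxO, fun h0 => ?_⟩, ?_, ?_, ?_⟩
  · have := hπ _ (hGV x)
    rw [h0] at this
    have h1 := hG1 x
    rw [← this] at h1
    simp at h1
  · refine ContDiff.contDiffOn ?_
    exact T.contDiff.comp (ρ.contDiff.prodMk ((contDiff_norm_sq ℝ).sub contDiff_const))
  · rintro z ⟨-, hz⟩
    rw [(hΦd z).fderiv]
    refine T.surjective.comp ?_
    rintro ⟨w, r⟩
    have hzz : inner ℝ z (π z : Amb n) ≠ 0 := by
      have h1 : inner ℝ (z - π z) (π z : Amb n) = 0 :=
        Submodule.inner_left_of_mem_orthogonal (π z).2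
          (V.sub_starProjection_mem_orthogonal z)
      rw [inner_sub_left, sub_eq_zero] at h1
      rw [h1]
      exact inner_self_ne_zero.2 (by simpa using hz)
    -- The summand `w` gives the `Vᗮ`-component; the multiple of `π z`, invisible to `ρ`, corrects
    -- the derivative `2⟨z, ·⟩` of the squared norm to `r`.
    refine ⟨(w : Amb n) + ((r / 2 - inner ℝ z (w : Amb n)) / inner ℝ z (π z : Amb n)) •
      (π z : Amb n), Prod.ext ?_ ?_⟩
    · have h1 : ρ (π z : Amb n) = 0 := (hρV _).2 (π z).2
      have h2 : ρ (w : Amb n) = w := Vᗮ.orthogonalProjectionOnto_mem_subspace_eq_self w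
      change ρ _ = w
      rw [map_add, map_smul, h1, h2, smul_zero, add_zero]
    · change (2 : ℕ) • inner ℝ z _ = r
      rw [nsmul_eq_mul, Nat.cast_ofNat]
      rw [inner_add_right, inner_smul_right]
      field_simp
      ring
  · ext z
    constructor
    · rintro ⟨⟨x', rfl⟩, hz⟩
      exact ⟨hz, (hΦ0 _).2 ⟨hGV x', hG1 x'⟩⟩
    · rintro ⟨hz, hz0⟩
      obtain ⟨h1, h2⟩ := (hΦ0 z).1 hz0
      exact ⟨hOV z hz.1 h1 h2, hz⟩

variable {F N : M → Amb n} {κ : Fin n → ℝ} {κ₁ κ₂ : ℝ}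

/-- By the local statement, the set of points where `w` is orthogonal to the focal span is open with
open complement, hence everything once it is nonempty. -/
theorem orthogonal_focal_of_orthogonal_focal [PreconnectedSpace M]
    (hF : IsOrientedHypersurface I F N) (hi : IsIsoparametric I F N κ)
    (hκ : ∀ i, κ i = κ₁ ∨ κ i = κ₂) (hne : κ₁ ≠ κ₂) (hκκ : κ₁ * κ₂ = -1) {w : Amb n} {x : M}
    (hw : inner ℝ w (focalMap F N κ₁ x) = 0)
    (hw' : ∀ v, inner ℝ w (differential I (focalMap F N κ₁) x v) = 0) (z : M) :
    inner ℝ w (focalMap F N κ₁ z) = 0 ∧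
      ∀ v, inner ℝ w (differential I (focalMap F N κ₁) z v) = 0 := by
  let Z : Set M := {z | inner ℝ w (focalMap F N κ₁ z) = 0 ∧
      ∀ v, inner ℝ w (differential I (focalMap F N κ₁) z v) = 0}
  have hP : ContMDiff I 𝓘(ℝ, Amb n) ∞ (focalMap F N κ₁) := by
    have h1 : focalMap F N κ₁ = fun z => (1 : ℝ) • N z + κ₁ • F z := by
      funext z; simp [focalMap]
    rw [h1]
    exact contMDiff_add_smul I hF.smooth_normal hF.smooth 1 κ₁
  have hloc : ∀ x₀ : M, ∃ W ∈ 𝓝 x₀, ∀ a ∈ W, ∀ b ∈ W, a ∈ Z → b ∈ Z := by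
    intro x₀
    obtain ⟨W, hW, hWU, hWw⟩ := (hi.isLocalIsoparametric hF x₀).eventually_orthogonal_focal
      hF.finrank_eq hκ hne hκκ (mem_chartInterior I x₀)
    have hchart : ∀ y ∈ W, (extChartAt I x₀).symm y ∈ Z ↔
        inner ℝ w (focalMap (F ∘ (extChartAt I x₀).symm) (N ∘ (extChartAt I x₀).symm) κ₁ y) = 0 ∧
        ∀ v, inner ℝ w (fderiv ℝ (focalMap (F ∘ (extChartAt I x₀).symm)
          (N ∘ (extChartAt I x₀).symm) κ₁) y v) = 0 := by
      intro y hy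
      obtain ⟨J, hJ⟩ := exists_differential_eq (n := n) I (hWU hy)
      refine and_congr_right fun _ => ?_
      simp only [hJ _ hP]
      exact ⟨fun h v => J.apply_symm_apply v ▸ h (J.symm v), fun h v => h (J v)⟩
    refine ⟨_, preimage_extChartAt_mem_nhds I hW, ?_⟩
    rintro a ⟨ha, haW⟩ b ⟨hb, hbW⟩ haZ
    rw [← (extChartAt I x₀).left_inv ha, hchart _ haW] at haZ
    rw [← (extChartAt I x₀).left_inv hb, hchart _ hbW]
    exact hWw w _ haW _ hbW haZ.1 haZ.2
  have hclopen : IsClopen Z := by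
    constructor
    · rw [← isOpen_compl_iff, isOpen_iff_mem_nhds]
      intro a ha
      obtain ⟨W, hW, hWZ⟩ := hloc a
      filter_upwards [hW] with b hb hbZ
      exact ha (hWZ b hb a (mem_of_mem_nhds hW) hbZ)
    · rw [isOpen_iff_mem_nhds]
      intro a ha
      obtain ⟨W, hW, hWZ⟩ := hloc a
      filter_upwards [hW] with b hb
      exact hWZ a (mem_of_mem_nhds hW) b hb ha
  have : Z = univ := hclopen.eq_univ ⟨x, hw, hw'⟩
  have hz : z ∈ Z := this ▸ mem_univ z
  exact hz

/-- The span of the focal map and of its differential does not depend on the point. -/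
theorem focalSpan_eq [PreconnectedSpace M]
    (hF : IsOrientedHypersurface I F N) (hi : IsIsoparametric I F N κ)
    (hκ : ∀ i, κ i = κ₁ ∨ κ i = κ₂) (hne : κ₁ ≠ κ₂) (hκκ : κ₁ * κ₂ = -1) (x z : M) :
    Submodule.span ℝ {focalMap F N κ₁ x} ⊔ (differential I (focalMap F N κ₁) x).range =
      Submodule.span ℝ {focalMap F N κ₁ z} ⊔ (differential I (focalMap F N κ₁) z).range := by
  have hmem : ∀ x w, w ∈ (Submodule.span ℝ {focalMap F N κ₁ x} ⊔
      (differential I (focalMap F N κ₁) x).range)ᗮ ↔ inner ℝ w (focalMap F N κ₁ x) = 0 ∧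
        ∀ v, inner ℝ w (differential I (focalMap F N κ₁) x v) = 0 := by
    intro x w
    rw [← Submodule.inf_orthogonal, Submodule.mem_inf, Submodule.mem_orthogonal_singleton_iff_inner_left,
      Submodule.mem_orthogonal']
    refine and_congr_right fun _ => ⟨fun h v => h _ ⟨v, rfl⟩, ?_⟩
    rintro h _ ⟨v, rfl⟩
    exact h v
  have hle : ∀ x z, (Submodule.span ℝ {focalMap F N κ₁ x} ⊔
      (differential I (focalMap F N κ₁) x).range)ᗮ ≤ (Submodule.span ℝ {focalMap F N κ₁ z} ⊔
      (differential I (focalMap F N κ₁) z).range)ᗮ := by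
    intro x z w hw
    rw [hmem] at hw ⊢
    exact orthogonal_focal_of_orthogonal_focal hF hi hκ hne hκκ hw.1 hw.2 z
  rw [← Submodule.orthogonal_orthogonal (Submodule.span ℝ {focalMap F N κ₁ x} ⊔ _),
    le_antisymm (hle x z) (hle z x), Submodule.orthogonal_orthogonal]

end FocalSubmanifold

/-! ### Parallel hypersurfaces: frames, principal curvatures and mean curvature vector. -/

section ParallelHypersurfaces

theorem sum_comp_eq_of_ncard {n l : ℕ} {κ : Fin n → ℝ} {κ₁ κ₂ : ℝ} (hne : κ₁ ≠ κ₂)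
    (hκ : ∀ i, κ i = κ₁ ∨ κ i = κ₂) (h₁ : {i | κ i = κ₁}.ncard = l)
    (h₂ : {i | κ i = κ₂}.ncard = n - l) (hl : l ≤ n) (φ : ℝ → ℝ) :
    ∑ i, φ (κ i) = l * φ κ₁ + ((n : ℝ) - l) * φ κ₂ := by
  classical
  have e₁ : {i | κ i = κ₁} = ((Finset.univ.filter fun i => κ i = κ₁ : Finset (Fin n)) : Set _) := by
    ext; simp
  have e₂ : {i | κ i = κ₂} =
      ((Finset.univ.filter fun i => ¬ κ i = κ₁ : Finset (Fin n)) : Set _) := by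
    ext i
    simp only [mem_ofPred_eq, Finset.coe_filter, Finset.mem_univ, true_and]
    rcases hκ i with h | h <;> simp [h, hne, hne.symm]
  rw [e₁, ncard_coe_finset] at h₁
  rw [e₂, ncard_coe_finset] at h₂
  have s₁ : ∑ i with κ i = κ₁, φ (κ i) = l * φ κ₁ := by
    rw [Finset.sum_congr rfl fun i hi => by rw [(Finset.mem_filter.1 hi).2], Finset.sum_const, h₁,
      nsmul_eq_mul]
  have s₂ : ∑ i with ¬ κ i = κ₁, φ (κ i) = ((n : ℝ) - l) * φ κ₂ := by
    rw [Finset.sum_congr rfl fun i hi => by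
      rw [(hκ i).resolve_left (Finset.mem_filter.1 hi).2], Finset.sum_const, h₂, nsmul_eq_mul,
      Nat.cast_sub hl]
  rw [← Finset.sum_filter_add_sum_filter_not _ (fun i => κ i = κ₁), s₁, s₂]

variable {n : ℕ} {E : Type*} [NormedAddCommGroup E] [NormedSpace ℝ E]
  {H : Type*} [TopologicalSpace H] {I : ModelWithCorners ℝ E H}
  {M : Type*} [TopologicalSpace M] [ChartedSpace H M]

theorem IsPrincipalFrame.hasPrincipalCurvatures {F N : M → Amb n} {x : M} {κ : Fin n → ℝ}
    {e : Fin n → TangentSpace I x}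
    (h : IsPrincipalFrame (differential I F x).toLinearMap (differential I N x).toLinearMap
      (F x) (N x) κ e) : HasPrincipalCurvatures I F N x κ := by
  refine ⟨e, fun i j => ⟨h.orthonormal i j, ?_⟩⟩
  have h1 := h.weingarten i
  have h2 := h.orthonormal i j
  simp only [ContinuousLinearMap.coe_coe] at h1 h2
  rw [secondFundamentalForm, h1, inner_smul_left, h2]
  split_ifs <;> simp

/-- The unit normal of the parallel hypersurface `parallelMap F N θ`. -/
def parallelNormal (F N : M → Amb n) (θ : ℝ) (x : M) : Amb n :=
  (-Real.sin θ) • F x + Real.cos θ • N x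

variable {F N : M → Amb n} {κ : Fin n → ℝ}

theorem differential_parallelMap (hF : IsOrientedHypersurface I F N) (θ : ℝ) (x : M)
    (v : TangentSpace I x) : differential I (parallelMap F N θ) x v =
      Real.cos θ • differential I F x v + Real.sin θ • differential I N x v :=
  differential_add_smul I hF.smooth hF.smooth_normal _ _ x v

theorem differential_parallelNormal (hF : IsOrientedHypersurface I F N) (θ : ℝ) (x : M)
    (v : TangentSpace I x) : differential I (parallelNormal F N θ) x v =
      (-Real.sin θ) • differential I F x v + Real.cos θ • differential I N x v :=
  differential_add_smul I hF.smooth hF.smooth_normal _ _ x v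

/-- The factors `cos θ - κᵢ sin θ` control both immersivity and rank: focal distances are their
zeros. -/
theorem differential_parallelMap_frame (hF : IsOrientedHypersurface I F N) (θ : ℝ) {x : M}
    {e : Fin n → TangentSpace I x} (he : IsPrincipalFrame (differential I F x).toLinearMap
      (differential I N x).toLinearMap (F x) (N x) κ e) (i : Fin n) :
    differential I (parallelMap F N θ) x (e i) =
      (Real.cos θ - κ i * Real.sin θ) • differential I F x (e i) := by
  have := he.weingarten i
  simp only [ContinuousLinearMap.coe_coe] at this
  rw [differential_parallelMap hF, this]
  module

theorem differential_parallelNormal_frame (hF : IsOrientedHypersurface I F N) (θ : ℝ) {x : M}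
    {e : Fin n → TangentSpace I x} (he : IsPrincipalFrame (differential I F x).toLinearMap
      (differential I N x).toLinearMap (F x) (N x) κ e) (i : Fin n) :
    differential I (parallelNormal F N θ) x (e i) =
      (-(Real.sin θ + κ i * Real.cos θ)) • differential I F x (e i) := by
  have := he.weingarten i
  simp only [ContinuousLinearMap.coe_coe] at this
  rw [differential_parallelNormal hF, this]
  module

theorem norm_smul_add_smul_of_orthonormal {V : Type*} [NormedAddCommGroup V]
    [InnerProductSpace ℝ V] {u v : V} (hu : ‖u‖ = 1) (hv : ‖v‖ = 1) (huv : inner ℝ u v = (0 : ℝ))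
    {a b : ℝ} (hab : a ^ 2 + b ^ 2 = 1) : ‖a • u + b • v‖ = 1 := by
  have : ‖a • u + b • v‖ ^ 2 = 1 := by
    rw [norm_add_sq_real, norm_smul, norm_smul, hu, hv, inner_smul_left, inner_smul_right, huv]
    simpa using hab
  exact (pow_eq_one_iff_of_nonneg (norm_nonneg _) two_ne_zero).1 this

theorem norm_parallelMap (hF : IsOrientedHypersurface I F N) (θ : ℝ) (x : M) :
    ‖parallelMap F N θ x‖ = 1 :=
  norm_smul_add_smul_of_orthonormal (hF.mem_sphere x) (hF.norm_normal x)
    (by rw [real_inner_comm, hF.normal_tangent_sphere]) (Real.cos_sq_add_sin_sq θ)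

theorem HasPrincipalCurvatures.sum_eq [FiniteDimensional ℝ E] {F N : M → Amb n} (hE : finrank ℝ E = n) {x : M}
    {κ κ' : Fin n → ℝ} (h : HasPrincipalCurvatures I F N x κ)
    (h' : HasPrincipalCurvatures I F N x κ') : ∑ i, κ i = ∑ i, κ' i := by
  obtain ⟨e, he⟩ := h
  obtain ⟨e', he'⟩ := h'
  have : FiniteDimensional ℝ (TangentSpace I x) := inferInstanceAs (FiniteDimensional ℝ E)
  have hT : finrank ℝ (TangentSpace I x) = n := hE
  let A := (differential I F x).toLinearMap
  let B := (differential I N x).toLinearMap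
  exact sum_eq_of_diagonalizing hT ((innerₗ (Amb n)).compl₁₂ A A)
    (-(innerₗ (Amb n)).compl₁₂ B A) (fun i j => (he i j).1) (fun i j => (he i j).2)
    (fun i j => (he' i j).1) (fun i j => (he' i j).2)

variable [IsManifold I ∞ M] [BoundarylessManifold I M]

/-- The second fundamental form depends on the normal vector at the given point only. -/
theorem exists_secondFundamentalForm_eq_inner {G : M → Amb n} (hG : ContMDiff I 𝓘(ℝ, Amb n) ∞ G)
    (x : M) : ∃ S : TangentSpace I x → TangentSpace I x → Amb n, ∀ N' : M → Amb n,
      IsOrientedHypersurface I G N' → ∀ v w,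
        secondFundamentalForm I G N' x v w = inner ℝ (N' x) (S v w) := by
  obtain ⟨J, hJ⟩ := exists_differential_eq_self (n := n) I x
  set g := G ∘ (extChartAt I x).symm with hg
  set y₀ := extChartAt I x x with hy₀
  have hU := (isOpen_chartInterior I x).mem_nhds (mem_chartInterior I x)
  have hgs : ContDiffAt ℝ ∞ g y₀ := (contDiffOn_comp_extChartAt_symm I hG x).contDiffAt hU
  have hgs' : DifferentiableAt ℝ (fderiv ℝ g) y₀ :=
    (hgs.fderiv_right (m := ∞) (by simp)).differentiableAt (by simp)
  -- The Hessian of `G` in a chart: differentiating `⟨N', dG w⟩ = 0` turns `-⟨dN' v, dG w⟩` into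
  -- `⟨N', D²g(v, w)⟩`.
  refine ⟨fun v w => fderiv ℝ (fderiv ℝ g) y₀ (J v) (J w), fun N' hN' v w => ?_⟩
  have hd : DifferentiableAt ℝ (N' ∘ (extChartAt I x).symm) y₀ :=
    ((contDiffOn_comp_extChartAt_symm I hN'.smooth_normal x).contDiffAt hU).differentiableAt
      (by simp)
  have := inner_fderiv_add_inner_fderiv_eq_zero (c := 0) hd
    (hgs'.clm_apply (differentiableAt_const (J w))) (by
      filter_upwards [hU] with y hy
      obtain ⟨J', hJ'⟩ := exists_differential_eq (n := n) I hy
      have h1 := hN'.normal_orthogonal _ (J'.symm (J w))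
      rwa [hJ' G hG, J'.apply_symm_apply] at h1) (J v)
  rw [fderiv_clm_apply_const hgs'] at this
  rw [secondFundamentalForm, hJ G hG, hJ N' hN'.smooth_normal]
  have h2 : (N' ∘ (extChartAt I x).symm) y₀ = N' x := by simp [hy₀]
  rw [h2] at this
  linarith

theorem exists_frame_parallel (hF : IsOrientedHypersurface I F N) (hi : IsIsoparametric I F N κ)
    {θ : ℝ} (hθ : ∀ i, Real.cos θ - κ i * Real.sin θ ≠ 0) (x : M) :
    ∃ e, IsPrincipalFrame (differential I (parallelMap F N θ) x).toLinearMap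
      (differential I (parallelNormal F N θ) x).toLinearMap (parallelMap F N θ x)
      (parallelNormal F N θ x)
      (fun i => (Real.sin θ + κ i * Real.cos θ) / (Real.cos θ - κ i * Real.sin θ)) e := by
  obtain ⟨e, he⟩ := (hi x).exists_frame hF
  have hFN : inner ℝ (F x) (N x) = (0 : ℝ) := he.inner_f_ν
  have hNF : inner ℝ (N x) (F x) = (0 : ℝ) := hF.normal_tangent_sphere x
  have hFF : inner ℝ (F x) (F x) = (1 : ℝ) := by
    rw [real_inner_self_eq_norm_sq, hF.mem_sphere, one_pow]
  have hNN : inner ℝ (N x) (N x) = (1 : ℝ) := by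
    rw [real_inner_self_eq_norm_sq, hF.norm_normal, one_pow]
  have hFe : ∀ i, inner ℝ (F x) (differential I F x (e i)) = 0 := he.inner_f
  have hNe : ∀ i, inner ℝ (N x) (differential I F x (e i)) = 0 := he.inner_ν
  have hD : ∀ i, differential I (parallelMap F N θ) x
      ((Real.cos θ - κ i * Real.sin θ)⁻¹ • e i) = differential I F x (e i) := by
    intro i
    rw [map_smul, differential_parallelMap_frame hF θ he, smul_smul, inv_mul_cancel₀ (hθ i),
      one_smul]
  refine ⟨fun i => (Real.cos θ - κ i * Real.sin θ)⁻¹ • e i, ⟨norm_parallelMap hF θ x, ?_, ?_,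
    fun i => ?_, fun i => ?_, fun i j => ?_⟩, fun i => ?_⟩
  · exact norm_smul_add_smul_of_orthonormal (hF.mem_sphere x) (hF.norm_normal x) hFN
      (by rw [neg_sq, Real.sin_sq_add_cos_sq])
  · simp only [parallelMap, parallelNormal, inner_add_left, inner_add_right, inner_smul_left,
      inner_smul_right, hFN, hNF, hFF, hNN, RCLike.conj_to_real]
    ring
  · rw [ContinuousLinearMap.coe_coe, hD, parallelMap, inner_add_left, inner_smul_left,
      inner_smul_left, hFe, hNe, mul_zero, mul_zero, add_zero]
  · rw [ContinuousLinearMap.coe_coe, hD, parallelNormal, inner_add_left, inner_smul_left,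
      inner_smul_left, hFe, hNe, mul_zero, mul_zero, add_zero]
  · rw [ContinuousLinearMap.coe_coe, hD, hD]
    exact he.orthonormal i j
  · rw [ContinuousLinearMap.coe_coe, ContinuousLinearMap.coe_coe, hD, map_smul,
      differential_parallelNormal_frame hF θ he, smul_smul]
    congr 1
    ring

/-- A parallel hypersurface is an immersion only away from the focal distances. -/
theorem ne_zero_of_injective_differential (hF : IsOrientedHypersurface I F N)
    (hi : IsIsoparametric I F N κ) {θ : ℝ} {x : M}
    (hinj : Function.Injective (differential I (parallelMap F N θ) x)) (i : Fin n) :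
    Real.cos θ - κ i * Real.sin θ ≠ 0 := by
  intro h0
  obtain ⟨e, he⟩ := (hi x).exists_frame hF
  have h1 := differential_parallelMap_frame hF θ he i
  rw [h0, zero_smul] at h1
  have h2 : e i = 0 := hinj (h1.trans (map_zero _).symm)
  exact he.linearIndependent.ne_zero i h2

theorem hasMeanCurvature_parallel (hF : IsOrientedHypersurface I F N)
    (hi : IsIsoparametric I F N κ) {θ : ℝ} (hθ : ∀ i, Real.cos θ - κ i * Real.sin θ ≠ 0) (x : M) :
    HasMeanCurvature I (parallelMap F N θ) (parallelNormal F N θ) x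
      (∑ i, (Real.sin θ + κ i * Real.cos θ) / (Real.cos θ - κ i * Real.sin θ)) := by
  obtain ⟨e, he⟩ := exists_frame_parallel hF hi hθ x
  exact ⟨_, he.hasPrincipalCurvatures, rfl⟩

variable [FiniteDimensional ℝ E]

/-- The mean curvature vector does not depend on the choice of the unit normal. -/
theorem HasMeanCurvature.smul_normal_eq {G N₁ N₂ : M → Amb n} (h₁ : IsOrientedHypersurface I G N₁)
    (h₂ : IsOrientedHypersurface I G N₂) {x : M} {η₁ η₂ : ℝ} (hη₁ : HasMeanCurvature I G N₁ x η₁)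
    (hη₂ : HasMeanCurvature I G N₂ x η₂) : η₁ • N₁ x = η₂ • N₂ x := by
  obtain ⟨κ, hκ, rfl⟩ := hη₁
  obtain ⟨κ', hκ', rfl⟩ := hη₂
  obtain ⟨e, he⟩ := hκ'.exists_frame h₂
  obtain ⟨S, hS⟩ := exists_secondFundamentalForm_eq_inner h₁.smooth x
  set ε : ℝ := inner ℝ (N₂ x) (N₁ x) with hε
  -- Both normals are orthogonal to `G x` and to the image of `dG`, which leaves a single line in
  -- the adapted frame. Then `ε² = 1`, and curvatures and normal change sign together.
  have hN : N₁ x = ε • N₂ x := by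
    rw [he.eq_sum (N₁ x), real_inner_comm, h₁.normal_tangent_sphere, zero_smul, zero_add,
      Finset.sum_eq_zero, add_zero]
    intro i _
    rw [real_inner_comm, ContinuousLinearMap.coe_coe, h₁.normal_orthogonal, zero_smul]
  have hε2 : ε * ε = 1 := by
    have := h₁.norm_normal x
    rw [hN, norm_smul, h₂.norm_normal, mul_one, Real.norm_eq_abs] at this
    rw [← abs_mul_abs_self, this, one_mul]
  have h3 : HasPrincipalCurvatures I G N₂ x (fun i => ε * κ i) := by
    obtain ⟨e', he'⟩ := hκ
    refine ⟨e', fun i j => ⟨(he' i j).1, ?_⟩⟩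
    have h4 := (he' i j).2
    rw [hS _ h₁, hN, inner_smul_left, ← hS _ h₂] at h4
    simp only [RCLike.conj_to_real] at h4
    calc _ = ε * (ε * secondFundamentalForm I G N₂ x (e' i) (e' j)) := by
          rw [← mul_assoc, hε2, one_mul]
      _ = _ := by rw [h4]; split_ifs <;> simp
  have h5 := h3.sum_eq h₂.finrank_eq hκ'
  rw [hN, ← h5, ← Finset.mul_sum, smul_smul, mul_comm]

theorem isOrientedHypersurface_parallel (hF : IsOrientedHypersurface I F N)
    (hi : IsIsoparametric I F N κ) {θ : ℝ} (hθ : ∀ i, Real.cos θ - κ i * Real.sin θ ≠ 0) :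
    IsOrientedHypersurface I (parallelMap F N θ) (parallelNormal F N θ) where
  finrank_eq := hF.finrank_eq
  smooth := contMDiff_add_smul I hF.smooth hF.smooth_normal _ _
  immersion x := by
    obtain ⟨e, he⟩ := exists_frame_parallel hF hi hθ x
    have : FiniteDimensional ℝ (TangentSpace I x) := inferInstanceAs (FiniteDimensional ℝ E)
    exact he.injective hF.finrank_eq
  mem_sphere := norm_parallelMap hF θ
  smooth_normal := contMDiff_add_smul I hF.smooth hF.smooth_normal _ _
  norm_normal x := (exists_frame_parallel hF hi hθ x).choose_spec.norm_ν
  normal_tangent_sphere x := by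
    rw [real_inner_comm]
    exact (exists_frame_parallel hF hi hθ x).choose_spec.inner_f_ν
  normal_orthogonal x v := by
    obtain ⟨e, he⟩ := exists_frame_parallel hF hi hθ x
    have : FiniteDimensional ℝ (TangentSpace I x) := inferInstanceAs (FiniteDimensional ℝ E)
    exact he.inner_ν_apply hF.finrank_eq v

theorem finrank_range_differential_parallelMap (hF : IsOrientedHypersurface I F N)
    (hi : IsIsoparametric I F N κ) (θ : ℝ) (x : M) :
    finrank ℝ (differential I (parallelMap F N θ) x).range =
      {i | Real.cos θ - κ i * Real.sin θ ≠ 0}.ncard := by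
  obtain ⟨e, he⟩ := (hi x).exists_frame hF
  have : FiniteDimensional ℝ (TangentSpace I x) := inferInstanceAs (FiniteDimensional ℝ E)
  exact he.finrank_range hF.finrank_eq (differential_parallelMap_frame hF θ he)

end ParallelHypersurfaces

/-! ### The ordinary differential equation for the angle and its first integral. -/

section AngleEquation

/-- The mean curvature of the parallel hypersurface with cosine `c` and sine `s`. -/
def parallelMeanCurvature (m₁ m₂ κ₁ κ₂ c s : ℝ) : ℝ :=
  m₁ * ((s + κ₁ * c) / (c - κ₁ * s)) + m₂ * ((s + κ₂ * c) / (c - κ₂ * s))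

/-- The relation `H P = n (Q + b)` in disguise: clearing denominators and using `κ₁ κ₂ = -1` makes
the right side affine in `Q`, which linearizes the flow. -/
theorem parallelMeanCurvature_mul {m₁ m₂ κ₁ κ₂ c s : ℝ} (hκκ : κ₁ * κ₂ = -1)
    (hcs : c ^ 2 + s ^ 2 = 1) (h₁ : c - κ₁ * s ≠ 0) (h₂ : c - κ₂ * s ≠ 0) :
    parallelMeanCurvature m₁ m₂ κ₁ κ₂ c s * (2 * ((c - κ₁ * s) * (c - κ₂ * s))) =
      (m₁ + m₂) * ((κ₁ + κ₂) * (c ^ 2 - s ^ 2) + 4 * (s * c)) + (m₁ - m₂) * (κ₁ - κ₂) := by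
  have e : parallelMeanCurvature m₁ m₂ κ₁ κ₂ c s * (2 * ((c - κ₁ * s) * (c - κ₂ * s))) =
      2 * (m₁ * ((s + κ₁ * c) * (c - κ₂ * s)) + m₂ * ((s + κ₂ * c) * (c - κ₁ * s))) := by
    have h : ∀ p q A B : ℝ, p ≠ 0 → q ≠ 0 → (m₁ * (A / p) + m₂ * (B / q)) * (2 * (p * q)) =
        2 * (m₁ * (A * q) + m₂ * (B * p)) := by
      intro p q A B hp hq
      field_simp
    exact h _ _ _ _ h₁ h₂
  rw [e]
  linear_combination (-2 * (m₁ + m₂) * s * c) * hκκ + (m₁ - m₂) * (κ₁ - κ₂) * hcs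

/-- `(P, Q)` is `(2, a)` rotated by the angle `2ξ`, so its norm is constant. -/
theorem focal_product_sq {κ₁ κ₂ c s : ℝ} (hκκ : κ₁ * κ₂ = -1) (hcs : c ^ 2 + s ^ 2 = 1) :
    (2 * ((c - κ₁ * s) * (c - κ₂ * s))) ^ 2 +
      ((κ₁ + κ₂) * (c ^ 2 - s ^ 2) + 4 * (s * c)) ^ 2 = (κ₁ + κ₂) ^ 2 + 4 := by
  have e : 2 * ((c - κ₁ * s) * (c - κ₂ * s)) =
      2 * (c ^ 2 - s ^ 2) - (κ₁ + κ₂) * (2 * (s * c)) := by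
    linear_combination 2 * s ^ 2 * hκκ
  rw [e]
  linear_combination ((κ₁ + κ₂) ^ 2 + 4) * (c ^ 2 + s ^ 2 + 1) * hcs

theorem pos_of_ne_zero_of_continuousOn {p : ℝ → ℝ} {T : ℝ} (hp : ContinuousOn p (Ico 0 T))
    (h0 : 0 < p 0) (hne : ∀ t ∈ Ico 0 T, p t ≠ 0) {t : ℝ} (ht : t ∈ Ico 0 T) : 0 < p t := by
  by_contra hneg
  have hsub : Icc 0 t ⊆ Ico 0 T := fun u hu => ⟨hu.1, hu.2.trans_lt ht.2⟩
  obtain ⟨u, hu, hu0⟩ := intermediate_value_Icc' ht.1 (hp.mono hsub) ⟨not_lt.1 hneg, h0.le⟩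
  exact hne u (hsub hu) hu0

/-- The solution of a linear equation with constant coefficients. -/
theorem eq_of_hasDerivWithinAt_linear {Q : ℝ → ℝ} {T r b : ℝ}
    (hQ : ∀ t ∈ Ico 0 T, HasDerivWithinAt Q (r * (Q t + b)) (Ico 0 T) t) {t : ℝ}
    (ht : t ∈ Ico 0 T) : Q t = (Q 0 + b) * Real.exp (r * t) - b := by
  have hsub : Icc 0 t ⊆ Ico 0 T := fun u hu => ⟨hu.1, hu.2.trans_lt ht.2⟩
  -- Integrating factor; a derivative within `Ico 0 T` is a right derivative at each of its points,
  -- which suffices for constancy.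
  have hder : ∀ u ∈ Ico 0 T, HasDerivWithinAt (fun u => (Q u + b) * Real.exp (-(r * u))) 0
      (Ico 0 T) u := by
    intro u hu
    have h1 : HasDerivAt (fun u => Real.exp (-(r * u))) (Real.exp (-(r * u)) * -(r * 1)) u :=
      (((hasDerivAt_id u).const_mul r).neg).exp
    have := ((hQ u hu).add_const b).mul h1.hasDerivWithinAt
    exact this.congr_deriv (by ring)
  have hc := constant_of_has_deriv_right_zero
    (fun u hu => ((hder u (hsub hu)).continuousWithinAt).mono hsub)
    (fun u hu => by
      have hu' : u ∈ Ico 0 T := hsub ⟨hu.1, hu.2.le⟩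
      refine (hder u hu').mono_of_mem_nhdsWithin ?_
      exact mem_of_superset (Ico_mem_nhdsGE hu'.2) (Ico_subset_Ico_left hu'.1)) t ⟨ht.1, le_rfl⟩
  simp only [mul_zero, neg_zero, Real.exp_zero, mul_one] at hc
  rw [← hc, mul_assoc, ← Real.exp_add]
  simp

/-- First integral of the equation for the angle of a flow by parallel hypersurfaces. -/
theorem angle_equation_solution {m₁ m₂ κ₁ κ₂ r b T : ℝ} {c s : ℝ → ℝ} (hκκ : κ₁ * κ₂ = -1)
    (hr : r = 2 * (m₁ + m₂)) (hb : (m₁ + m₂) * b = (m₁ - m₂) * (κ₁ - κ₂))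
    (hcs : ∀ t, c t ^ 2 + s t ^ 2 = 1) (hc0 : c 0 = 1) (hs0 : s 0 = 0)
    (h₁ : ∀ t ∈ Ico 0 T, c t - κ₁ * s t ≠ 0) (h₂ : ∀ t ∈ Ico 0 T, c t - κ₂ * s t ≠ 0)
    (hc : ∀ t ∈ Ico 0 T, HasDerivWithinAt c
      (-(parallelMeanCurvature m₁ m₂ κ₁ κ₂ (c t) (s t) * s t)) (Ico 0 T) t)
    (hs : ∀ t ∈ Ico 0 T, HasDerivWithinAt s
      (parallelMeanCurvature m₁ m₂ κ₁ κ₂ (c t) (s t) * c t) (Ico 0 T) t)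
    {t : ℝ} (ht : t ∈ Ico 0 T) :
    0 < c t - κ₁ * s t ∧ 0 < c t - κ₂ * s t ∧
      (κ₁ + κ₂) * (c t ^ 2 - s t ^ 2) + 4 * (s t * c t) =
        (κ₁ + κ₂ + b) * Real.exp (r * t) - b := by
  have hcc : ContinuousOn c (Ico 0 T) := fun t ht => (hc t ht).continuousWithinAt
  have hsc : ContinuousOn s (Ico 0 T) := fun t ht => (hs t ht).continuousWithinAt
  refine ⟨pos_of_ne_zero_of_continuousOn (hcc.sub (hsc.const_mul κ₁)) (by simp [hc0, hs0]) h₁ ht,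
    pos_of_ne_zero_of_continuousOn (hcc.sub (hsc.const_mul κ₂)) (by simp [hc0, hs0]) h₂ ht, ?_⟩
  have hQ : ∀ t ∈ Ico 0 T, HasDerivWithinAt
      (fun t => (κ₁ + κ₂) * (c t ^ 2 - s t ^ 2) + 4 * (s t * c t))
      (r * ((κ₁ + κ₂) * (c t ^ 2 - s t ^ 2) + 4 * (s t * c t) + b)) (Ico 0 T) t := by
    intro t ht
    have := ((((hc t ht).pow 2).sub ((hs t ht).pow 2)).const_mul (κ₁ + κ₂)).add
      (((hs t ht).mul (hc t ht)).const_mul 4)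
    refine this.congr_deriv ?_
    have e := parallelMeanCurvature_mul (m₁ := m₁) (m₂ := m₂) hκκ (hcs t) (h₁ t ht) (h₂ t ht)
    rw [hr]
    generalize parallelMeanCurvature m₁ m₂ κ₁ κ₂ (c t) (s t) = η at *
    push_cast
    -- This is `Q' = 2 P H = 2 n (Q + b)`, with `H` treated as an indeterminate.
    linear_combination 2 * e - 2 * hb - 4 * η * s t ^ 2 * hκκ
  have := eq_of_hasDerivWithinAt_linear hQ ht
  simpa [hc0, hs0] using this

/-- An angle is determined by its first integral and the signs of the focal factors. -/
theorem angle_unique {κ₁ κ₂ c s c' s' : ℝ} (hκκ : κ₁ * κ₂ = -1)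
    (hcs : c ^ 2 + s ^ 2 = 1) (hcs' : c' ^ 2 + s' ^ 2 = 1)
    (h₁ : 0 < c - κ₁ * s) (h₂ : 0 < c - κ₂ * s) (h₁' : 0 < c' - κ₁ * s') (h₂' : 0 < c' - κ₂ * s')
    (hQ : (κ₁ + κ₂) * (c ^ 2 - s ^ 2) + 4 * (s * c) =
      (κ₁ + κ₂) * (c' ^ 2 - s' ^ 2) + 4 * (s' * c')) : c = c' ∧ s = s' := by
  have hR := focal_product_sq hκκ hcs
  have hR' := focal_product_sq hκκ hcs'
  have hRR : 2 * ((c - κ₁ * s) * (c - κ₂ * s)) = 2 * ((c' - κ₁ * s') * (c' - κ₂ * s')) := by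
    rw [← sq_eq_sq₀ (by positivity) (by positivity)]
    rw [hQ] at hR
    linarith
  have e : ∀ c s : ℝ, 2 * ((c - κ₁ * s) * (c - κ₂ * s)) =
      2 * (c ^ 2 - s ^ 2) - (κ₁ + κ₂) * (2 * (s * c)) := fun c s => by
    linear_combination 2 * s ^ 2 * hκκ
  rw [e, e] at hRR
  have hpos : (κ₁ + κ₂) ^ 2 + 4 ≠ 0 := by positivity
  have hcos : c ^ 2 - s ^ 2 = c' ^ 2 - s' ^ 2 := mul_left_cancel₀ hpos (by
    linear_combination (κ₁ + κ₂) * hQ + 2 * hRR)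
  have hsin : s * c = s' * c' := mul_left_cancel₀ hpos (by
    linear_combination hQ - (κ₁ + κ₂) / 2 * hRR)
  -- Equal double angles mean that the difference of the angles has cosine `±1`; the antipodal case
  -- would reverse the sign of `c - κ₁ s`.
  have hprod : (c * c' + s * s' - 1) * (c * c' + s * s' + 1) = 0 := by
    have h1 : c ^ 2 = c' ^ 2 := by linarith
    have h2 : s ^ 2 = s' ^ 2 := by linarith
    linear_combination c' ^ 2 * h1 + s' ^ 2 * h2 + 2 * s' * c' * hsin +
      (c' ^ 2 + s' ^ 2 + 1) * hcs'
  have hsq : ∀ u v : ℝ, u ^ 2 + v ^ 2 = 0 → u = 0 ∧ v = 0 := fun u v h =>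
    ⟨pow_eq_zero_iff two_ne_zero |>.1 (by linarith [sq_nonneg u, sq_nonneg v]),
      pow_eq_zero_iff two_ne_zero |>.1 (by linarith [sq_nonneg u, sq_nonneg v])⟩
  rcases mul_eq_zero.1 hprod with h | h
  · have h3 : (c - c') ^ 2 + (s - s') ^ 2 = 0 := by linear_combination hcs + hcs' - 2 * h
    exact ⟨sub_eq_zero.1 (hsq _ _ h3).1, sub_eq_zero.1 (hsq _ _ h3).2⟩
  · have h3 : (c + c') ^ 2 + (s + s') ^ 2 = 0 := by linear_combination hcs + hcs' + 2 * h
    obtain ⟨h4, h5⟩ := hsq _ _ h3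
    rw [eq_neg_of_add_eq_zero_left h4, eq_neg_of_add_eq_zero_left h5] at h₁
    linarith

end AngleEquation

/-! ### Inverting the first integral by the arcsine. -/

section FocalAngle

/-- The angle `ξ` with `a cos 2ξ + 2 sin 2ξ = x` and `2 cos 2ξ - a sin 2ξ ≥ 0`. -/
def focalAngle (a x : ℝ) : ℝ :=
  (Real.arcsin (x / √(a ^ 2 + 4)) - Real.arcsin (a / √(a ^ 2 + 4))) / 2

theorem sqrt_sq_add_four_pos (a : ℝ) : 0 < √(a ^ 2 + 4) := Real.sqrt_pos.2 (by positivity)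

theorem abs_div_sqrt_le_one {a x : ℝ} (hx : x ^ 2 ≤ a ^ 2 + 4) :
    -1 ≤ x / √(a ^ 2 + 4) ∧ x / √(a ^ 2 + 4) ≤ 1 := by
  have h := Real.abs_le_sqrt hx
  rw [abs_le] at h
  have hw := sqrt_sq_add_four_pos a
  constructor
  · rw [le_div_iff₀ hw]; linarith
  · rw [div_le_one hw]; exact h.2

theorem abs_div_sqrt_lt_one {a x : ℝ} (hx : x ^ 2 < a ^ 2 + 4) :
    -1 < x / √(a ^ 2 + 4) ∧ x / √(a ^ 2 + 4) < 1 := by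
  have h := (Real.lt_sqrt (abs_nonneg x)).2 (by rwa [sq_abs])
  rw [abs_lt] at h
  have hw := sqrt_sq_add_four_pos a
  constructor
  · rw [lt_div_iff₀ hw]; linarith
  · rw [div_lt_one hw]; exact h.2

theorem cos_arcsin_div_sqrt (a x : ℝ) :
    Real.cos (Real.arcsin (x / √(a ^ 2 + 4))) = √(a ^ 2 + 4 - x ^ 2) / √(a ^ 2 + 4) := by
  have hpos : 0 < a ^ 2 + 4 := by positivity
  rw [Real.cos_arcsin, div_pow, Real.sq_sqrt hpos.le, ← Real.sqrt_div' _ hpos.le]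
  congr 1
  field_simp

/-- Identifies the phase: with `φ = arcsin (a / √(a² + 4))`, one has `a cos 2ξ + 2 sin 2ξ = √(a² +
4) sin (2ξ + φ)`. -/
theorem cos_arcsin_self_div_sqrt (a : ℝ) :
    Real.cos (Real.arcsin (a / √(a ^ 2 + 4))) = 2 / √(a ^ 2 + 4) := by
  rw [cos_arcsin_div_sqrt, add_sub_cancel_left]
  congr 1
  rw [show (4 : ℝ) = 2 ^ 2 by norm_num, Real.sqrt_sq (by norm_num)]

theorem cos_two_mul_focalAngle {a x : ℝ} (hx : x ^ 2 ≤ a ^ 2 + 4) :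
    Real.cos (2 * focalAngle a x) = (a * x + 2 * √(a ^ 2 + 4 - x ^ 2)) / (a ^ 2 + 4) := by
  have hx' := abs_div_sqrt_le_one hx
  have ha' := abs_div_sqrt_le_one (a := a) (x := a) (by linarith)
  rw [focalAngle, mul_div_cancel₀ _ two_ne_zero, Real.cos_sub, cos_arcsin_self_div_sqrt,
    cos_arcsin_div_sqrt, Real.sin_arcsin hx'.1 hx'.2, Real.sin_arcsin ha'.1 ha'.2]
  rw [div_mul_div_comm, div_mul_div_comm, ← add_div, Real.mul_self_sqrt (by positivity)]
  ring

theorem sin_two_mul_focalAngle {a x : ℝ} (hx : x ^ 2 ≤ a ^ 2 + 4) :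
    Real.sin (2 * focalAngle a x) = (2 * x - a * √(a ^ 2 + 4 - x ^ 2)) / (a ^ 2 + 4) := by
  have hx' := abs_div_sqrt_le_one hx
  have ha' := abs_div_sqrt_le_one (a := a) (x := a) (by linarith)
  rw [focalAngle, mul_div_cancel₀ _ two_ne_zero, Real.sin_sub, cos_arcsin_self_div_sqrt,
    cos_arcsin_div_sqrt, Real.sin_arcsin hx'.1 hx'.2, Real.sin_arcsin ha'.1 ha'.2]
  rw [div_mul_div_comm, div_mul_div_comm, ← sub_div, Real.mul_self_sqrt (by positivity)]
  ring

theorem contDiffAt_focalAngle {a x : ℝ} (hx : x ^ 2 < a ^ 2 + 4) :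
    ContDiffAt ℝ ∞ (focalAngle a) x := by
  have hx' := abs_div_sqrt_lt_one hx
  have h1 : ContDiffAt ℝ ∞ (fun x => Real.arcsin (x / √(a ^ 2 + 4))) x :=
    ContDiffAt.comp (g := Real.arcsin) (f := fun x => x / √(a ^ 2 + 4)) x
      (Real.contDiffAt_arcsin hx'.1.ne' hx'.2.ne) (contDiffAt_id.div_const _)
  exact (h1.sub contDiffAt_const).div_const _

/-- The root is `P` on this branch, so this is the relation `Q' = 2 P ξ'` solved for `ξ'`. -/
theorem hasDerivAt_focalAngle {a x : ℝ} (hx : x ^ 2 < a ^ 2 + 4) :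
    HasDerivAt (focalAngle a) (1 / (2 * √(a ^ 2 + 4 - x ^ 2))) x := by
  have hx' := abs_div_sqrt_lt_one hx
  have h1 := HasDerivAt.comp (h₂ := Real.arcsin) (h := fun x => x / √(a ^ 2 + 4)) x
    (Real.hasDerivAt_arcsin hx'.1.ne' hx'.2.ne) ((hasDerivAt_id x).div_const _)
  refine ((h1.sub_const _).div_const 2).congr_deriv ?_
  have hw := sqrt_sq_add_four_pos a
  have hs : 0 < √(a ^ 2 + 4 - x ^ 2) := Real.sqrt_pos.2 (by linarith)
  rw [← Real.cos_arcsin, cos_arcsin_div_sqrt]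
  field_simp

theorem continuous_focalAngle (a : ℝ) : Continuous (focalAngle a) :=
  ((Real.continuous_arcsin.comp (continuous_id.div_const _)).sub continuous_const).div_const _

theorem focalAngle_self (a : ℝ) : focalAngle a a = 0 := by simp [focalAngle]

/-- The limit angle is the first focal distance. -/
theorem focalAngle_sqrt {κ₁ κ₂ : ℝ} (hκκ : κ₁ * κ₂ = -1) (hκ : κ₂ < κ₁) :
    0 < focalAngle (κ₁ + κ₂) (κ₁ - κ₂) ∧ focalAngle (κ₁ + κ₂) (κ₁ - κ₂) < Real.pi / 2 ∧
      Real.cos (focalAngle (κ₁ + κ₂) (κ₁ - κ₂)) =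
        κ₁ * Real.sin (focalAngle (κ₁ + κ₂) (κ₁ - κ₂)) := by
  have hw : (κ₁ + κ₂) ^ 2 + 4 = (κ₁ - κ₂) ^ 2 := by linear_combination 4 * hκκ
  have hw0 : 0 < κ₁ - κ₂ := sub_pos.2 hκ
  have ha := abs_div_sqrt_lt_one (a := κ₁ + κ₂) (x := κ₁ + κ₂) (by linarith)
  have hone : (κ₁ - κ₂) / √((κ₁ + κ₂) ^ 2 + 4) = 1 := by
    rw [hw, Real.sqrt_sq hw0.le, div_self hw0.ne']
  have h1 : focalAngle (κ₁ + κ₂) (κ₁ - κ₂) < Real.pi / 2 := by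
    have := Real.neg_pi_div_two_lt_arcsin.2 ha.1
    rw [focalAngle, hone, Real.arcsin_one]
    linarith
  have h2 : 0 < focalAngle (κ₁ + κ₂) (κ₁ - κ₂) := by
    have := Real.arcsin_lt_pi_div_two.2 ha.2
    rw [focalAngle, hone, Real.arcsin_one]
    linarith
  refine ⟨h2, h1, ?_⟩
  have hc := cos_two_mul_focalAngle (a := κ₁ + κ₂) (x := κ₁ - κ₂) hw.ge
  have hs := sin_two_mul_focalAngle (a := κ₁ + κ₂) (x := κ₁ - κ₂) hw.ge
  rw [hw, sub_self, Real.sqrt_zero] at hc hs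
  have hcpos : 0 < Real.cos (focalAngle (κ₁ + κ₂) (κ₁ - κ₂)) :=
    Real.cos_pos_of_mem_Ioo ⟨by linarith [Real.pi_pos], h1⟩
  rw [Real.cos_two_mul] at hc
  rw [Real.sin_two_mul] at hs
  set C := Real.cos (focalAngle (κ₁ + κ₂) (κ₁ - κ₂))
  set S := Real.sin (focalAngle (κ₁ + κ₂) (κ₁ - κ₂))
  rw [eq_div_iff (by positivity)] at hc hs
  -- The double-angle formulas give `C (C - κ₁ S) = 0`, and `C > 0` since the angle lies in `(0,
  -- π/2)`.
  refine mul_left_cancel₀ (mul_pos hcpos (pow_pos hw0 2)).ne' ?_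
  linear_combination (1 / 2) * hc - κ₁ / 2 * hs

end FocalAngle

/-! ### Mean curvature flow by parallel hypersurfaces as an equation for the angle. -/

section ParallelFlow

variable {n l : ℕ} {E : Type*} [NormedAddCommGroup E] [NormedSpace ℝ E]
  {H : Type*} [TopologicalSpace H] {I : ModelWithCorners ℝ E H}
  {M : Type*} [TopologicalSpace M] [ChartedSpace H M] [IsManifold I ∞ M]
  [BoundarylessManifold I M] {F N : M → Amb n} {κ : Fin n → ℝ} {κ₁ κ₂ : ℝ}

theorem exists_index_of_ncard {m : ℕ} {p : Fin n → Prop} (h : {i | p i}.ncard = m) (hm : 0 < m) :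
    ∃ i, p i :=
  nonempty_of_ncard_ne_zero (by omega : {i | p i}.ncard ≠ 0)

theorem hasMeanCurvature_parallel_of_two (hF : IsOrientedHypersurface I F N)
    (hi : IsIsoparametric I F N κ) (hκ : ∀ i, κ i = κ₁ ∨ κ i = κ₂) (hne : κ₁ ≠ κ₂)
    (h₁ : {i | κ i = κ₁}.ncard = l) (h₂ : {i | κ i = κ₂}.ncard = n - l) (hl : l ≤ n) {θ : ℝ}
    (hθ : ∀ i, Real.cos θ - κ i * Real.sin θ ≠ 0) (x : M) :
    HasMeanCurvature I (parallelMap F N θ) (parallelNormal F N θ) x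
      (parallelMeanCurvature l (n - l) κ₁ κ₂ (Real.cos θ) (Real.sin θ)) := by
  have := hasMeanCurvature_parallel hF hi hθ x
  rwa [sum_comp_eq_of_ncard hne hκ h₁ h₂ hl
    (fun k => (Real.sin θ + k * Real.cos θ) / (Real.cos θ - k * Real.sin θ))] at this

/-- A flow by parallel hypersurfaces satisfies the first integral of the angle equation. -/
theorem IsParallelMCF.exists_angle [FiniteDimensional ℝ E] [Nonempty M]
    (hF : IsOrientedHypersurface I F N)
    (hi : IsIsoparametric I F N κ) (hκ : ∀ i, κ i = κ₁ ∨ κ i = κ₂) (hne : κ₁ ≠ κ₂)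
    (h₁ : {i | κ i = κ₁}.ncard = l) (h₂ : {i | κ i = κ₂}.ncard = n - l) (hl0 : 0 < l)
    (hl : l < n) (hκκ : κ₁ * κ₂ = -1) {b T : ℝ} (hb : n * b = (2 * l - n) * (κ₁ - κ₂))
    {Ghat : ℝ → M → Amb n} (hG : IsParallelMCF I F N Ghat (Ico 0 T)) :
    ∃ ξ : ℝ → ℝ, ∀ t ∈ Ico 0 T, Ghat t = parallelMap F N (ξ t) ∧
      0 < Real.cos (ξ t) - κ₁ * Real.sin (ξ t) ∧ 0 < Real.cos (ξ t) - κ₂ * Real.sin (ξ t) ∧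
      (κ₁ + κ₂) * (Real.cos (ξ t) ^ 2 - Real.sin (ξ t) ^ 2) +
        4 * (Real.sin (ξ t) * Real.cos (ξ t)) = (κ₁ + κ₂ + b) * Real.exp (2 * n * t) - b := by
  obtain ⟨⟨-, hM⟩, ξ, hξ0, hξ⟩ := hG
  obtain ⟨i₁, hi₁⟩ := exists_index_of_ncard h₁ hl0
  obtain ⟨i₂, hi₂⟩ := exists_index_of_ncard h₂ (by omega)
  obtain ⟨x⟩ := ‹Nonempty M›
  have hθ : ∀ t ∈ Ico 0 T, ∀ i, Real.cos (ξ t) - κ i * Real.sin (ξ t) ≠ 0 := by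
    intro t ht
    obtain ⟨Nhat, hN, -⟩ := hM t ht
    rw [hξ t ht] at hN
    exact ne_zero_of_injective_differential hF hi (hN.immersion x)
  have hder : ∀ t ∈ Ico 0 T, HasDerivWithinAt (fun u => Ghat u x)
      (parallelMeanCurvature l (n - l) κ₁ κ₂ (Real.cos (ξ t)) (Real.sin (ξ t)) •
        parallelNormal F N (ξ t) x) (Ico 0 T) t := by
    intro t ht
    obtain ⟨Nhat, hN, hmc⟩ := hM t ht
    obtain ⟨η, hη, hd⟩ := hmc x
    rw [hξ t ht] at hN hη
    rwa [hη.smul_normal_eq hN (isOrientedHypersurface_parallel hF hi (hθ t ht))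
      (hasMeanCurvature_parallel_of_two hF hi hκ hne h₁ h₂ hl.le (hθ t ht) x)] at hd
  have hNF : inner ℝ (N x) (F x) = (0 : ℝ) := hF.normal_tangent_sphere x
  have hFN : inner ℝ (F x) (N x) = (0 : ℝ) := by rw [real_inner_comm, hNF]
  have hFF : inner ℝ (F x) (F x) = (1 : ℝ) := by
    rw [real_inner_self_eq_norm_sq, hF.mem_sphere, one_pow]
  have hNN : inner ℝ (N x) (N x) = (1 : ℝ) := by
    rw [real_inner_self_eq_norm_sq, hF.norm_normal, one_pow]
  -- No regularity of `ξ` is assumed, so one differentiates `cos ξ` and `sin ξ`, read off from the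
  -- flow at one point, rather than `ξ` itself.
  have hcos : ∀ t ∈ Ico 0 T, Real.cos (ξ t) = inner ℝ (F x) (Ghat t x) := fun t ht => by
    rw [hξ t ht, parallelMap, inner_add_right, inner_smul_right, inner_smul_right, hFF, hFN]
    ring
  have hsin : ∀ t ∈ Ico 0 T, Real.sin (ξ t) = inner ℝ (N x) (Ghat t x) := fun t ht => by
    rw [hξ t ht, parallelMap, inner_add_right, inner_smul_right, inner_smul_right, hNN, hNF]
    ring
  have hc : ∀ t ∈ Ico 0 T, HasDerivWithinAt (fun t => Real.cos (ξ t))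
      (-(parallelMeanCurvature l (n - l) κ₁ κ₂ (Real.cos (ξ t)) (Real.sin (ξ t)) *
        Real.sin (ξ t))) (Ico 0 T) t := by
    intro t ht
    have := ((innerSL ℝ (F x)).hasFDerivAt.comp_hasDerivWithinAt t (hder t ht)).congr
      hcos (hcos t ht)
    refine this.congr_deriv ?_
    rw [innerSL_apply_apply, parallelNormal, inner_smul_right, inner_add_right, inner_smul_right,
      inner_smul_right, hFF, hFN]
    ring
  have hs : ∀ t ∈ Ico 0 T, HasDerivWithinAt (fun t => Real.sin (ξ t))
      (parallelMeanCurvature l (n - l) κ₁ κ₂ (Real.cos (ξ t)) (Real.sin (ξ t)) *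
        Real.cos (ξ t)) (Ico 0 T) t := by
    intro t ht
    have := ((innerSL ℝ (N x)).hasFDerivAt.comp_hasDerivWithinAt t (hder t ht)).congr
      hsin (hsin t ht)
    refine this.congr_deriv ?_
    rw [innerSL_apply_apply, parallelNormal, inner_smul_right, inner_add_right, inner_smul_right,
      inner_smul_right, hNN, hNF]
    ring
  refine ⟨ξ, fun t ht => ⟨hξ t ht, ?_⟩⟩
  exact angle_equation_solution (m₁ := l) (m₂ := n - l) (r := 2 * n) (b := b)
    (c := fun t => Real.cos (ξ t)) (s := fun t => Real.sin (ξ t)) hκκ (by ring)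
    (by linear_combination hb) (fun t => Real.cos_sq_add_sin_sq _) (by simp [hξ0]) (by simp [hξ0])
    (fun t ht => hi₁ ▸ hθ t ht i₁) (fun t ht => hi₂ ▸ hθ t ht i₂) hc hs ht

/-- Existence: the angle obtained by solving the first integral gives a flow. -/
theorem isParallelMCF_focalAngle [FiniteDimensional ℝ E]
    (hF : IsOrientedHypersurface I F N)
    (hi : IsIsoparametric I F N κ) (hκ : ∀ i, κ i = κ₁ ∨ κ i = κ₂) (hne : κ₁ ≠ κ₂)
    (h₁ : {i | κ i = κ₁}.ncard = l) (h₂ : {i | κ i = κ₂}.ncard = n - l)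
    (hl : l < n) (hκκ : κ₁ * κ₂ = -1) {b T : ℝ} (hb : n * b = (2 * l - n) * (κ₁ - κ₂))
    {q : ℝ → ℝ} (hq : ∀ t, q t = (κ₁ + κ₂ + b) * Real.exp (2 * n * t) - b)
    (hqT : ∀ t ∈ Ico 0 T, q t ^ 2 < (κ₁ + κ₂) ^ 2 + 4) :
    IsParallelMCF I F N (fun t => parallelMap F N (focalAngle (κ₁ + κ₂) (q t))) (Ico 0 T) := by
  set ξ : ℝ → ℝ := fun t => focalAngle (κ₁ + κ₂) (q t) with hξ
  have hq0 : q 0 = κ₁ + κ₂ := by rw [hq]; simp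
  have hξ0 : ξ 0 = 0 := by simp only [hξ, hq0, focalAngle_self]
  refine ⟨⟨?_, fun t ht => ?_⟩, ξ, hξ0, fun _ _ => rfl⟩
  · funext x
    change parallelMap F N (ξ 0) x = F x
    simp [hξ0, parallelMap]
  have hR : 0 < √((κ₁ + κ₂) ^ 2 + 4 - q t ^ 2) := Real.sqrt_pos.2 (by linarith [hqT t ht])
  have hpos : (0 : ℝ) < (κ₁ + κ₂) ^ 2 + 4 := by positivity
  have hcos : Real.cos (2 * ξ t) = _ := cos_two_mul_focalAngle (hqT t ht).le
  have hsin : Real.sin (2 * ξ t) = _ := sin_two_mul_focalAngle (hqT t ht).le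
  rw [eq_div_iff hpos.ne'] at hcos hsin
  rw [Real.cos_two_mul] at hcos
  rw [Real.sin_two_mul] at hsin
  have hcs := Real.cos_sq_add_sin_sq (ξ t)
  -- On the arcsine branch `P` is the positive root of `a² + 4 - q²`, so neither focal factor
  -- vanishes.
  have hprod : 2 * ((Real.cos (ξ t) - κ₁ * Real.sin (ξ t)) *
      (Real.cos (ξ t) - κ₂ * Real.sin (ξ t))) = √((κ₁ + κ₂) ^ 2 + 4 - q t ^ 2) := by
    refine mul_left_cancel₀ hpos.ne' ?_
    linear_combination 2 * hcos - (κ₁ + κ₂) * hsin + 2 * ((κ₁ + κ₂) ^ 2 + 4) *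
      Real.sin (ξ t) ^ 2 * hκκ - 2 * ((κ₁ + κ₂) ^ 2 + 4) * hcs
  have hQ : (κ₁ + κ₂) * (Real.cos (ξ t) ^ 2 - Real.sin (ξ t) ^ 2) +
      4 * (Real.sin (ξ t) * Real.cos (ξ t)) = q t := by
    refine mul_left_cancel₀ hpos.ne' ?_
    linear_combination (κ₁ + κ₂) * hcos + 2 * hsin - (κ₁ + κ₂) * ((κ₁ + κ₂) ^ 2 + 4) * hcs
  have hp₁ : Real.cos (ξ t) - κ₁ * Real.sin (ξ t) ≠ 0 := fun h0 => by
    rw [h0] at hprod; linarith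
  have hp₂ : Real.cos (ξ t) - κ₂ * Real.sin (ξ t) ≠ 0 := fun h0 => by
    rw [h0] at hprod; linarith
  have hθ : ∀ i, Real.cos (ξ t) - κ i * Real.sin (ξ t) ≠ 0 := fun i => by
    rcases hκ i with h | h <;> rwa [h]
  refine ⟨_, isOrientedHypersurface_parallel hF hi hθ, fun x =>
    ⟨_, hasMeanCurvature_parallel_of_two hF hi hκ hne h₁ h₂ hl.le hθ x, ?_⟩⟩
  have hη := parallelMeanCurvature_mul (m₁ := l) (m₂ := n - l) hκκ hcs hp₁ hp₂
  rw [hprod, hQ] at hη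
  have hq' : HasDerivAt q (2 * n * (q t + b)) t := by
    have h1 : HasDerivAt (fun t => Real.exp (2 * n * t)) (Real.exp (2 * n * t) * (2 * n * 1)) t :=
      ((hasDerivAt_id t).const_mul (2 * (n : ℝ))).exp
    have h2 := (h1.const_mul (κ₁ + κ₂ + b)).sub_const b
    rw [← funext hq] at h2
    refine h2.congr_deriv ?_
    rw [hq]
    ring
  have hξ' : HasDerivAt ξ
      (parallelMeanCurvature l (n - l) κ₁ κ₂ (Real.cos (ξ t)) (Real.sin (ξ t))) t := by
    refine ((hasDerivAt_focalAngle (hqT t ht)).comp t hq').congr_deriv ?_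
    rw [eq_div_of_mul_eq hR.ne' hη]
    field_simp
    linear_combination hb
  have hd := (hξ'.cos.smul_const (F x)).add (hξ'.sin.smul_const (N x))
  refine (hd.congr_deriv ?_).hasDerivWithinAt
  rw [parallelNormal]
  module

end ParallelFlow

/-! ### Normalization, uniform convergence and the focal submanifold. -/

section TwoPrincipalCurvatures

variable {n l : ℕ} {E : Type*} [NormedAddCommGroup E] [NormedSpace ℝ E]
  {H : Type*} [TopologicalSpace H] {I : ModelWithCorners ℝ E H}
  {M : Type*} [TopologicalSpace M] [ChartedSpace H M] {F N : M → Amb n} {κ : Fin n → ℝ}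
  {κ₁ κ₂ : ℝ}

theorem differential_smul {G : M → Amb n} (hG : ContMDiff I 𝓘(ℝ, Amb n) ∞ G) (c : ℝ) (x : M) :
    differential I (fun z => c • G z) x = c • differential I G x := by
  have : (fun z => c • G z) = fun z => c • G z + (0 : ℝ) • G z := by simp
  rw [this]
  ext1 v
  rw [differential_add_smul I hG hG]
  simp

theorem IsOrientedHypersurface.smul_normal (hF : IsOrientedHypersurface I F N) {σ : ℝ}
    (hσ : |σ| = 1) : IsOrientedHypersurface I F (fun x => σ • N x) where
  finrank_eq := hF.finrank_eq
  smooth := hF.smooth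
  immersion := hF.immersion
  mem_sphere := hF.mem_sphere
  smooth_normal := (contDiff_const_smul σ).contMDiff.comp hF.smooth_normal
  norm_normal x := by rw [norm_smul, hF.norm_normal, mul_one, Real.norm_eq_abs, hσ]
  normal_tangent_sphere x := by rw [inner_smul_left, hF.normal_tangent_sphere, mul_zero]
  normal_orthogonal x v := by rw [inner_smul_left, hF.normal_orthogonal, mul_zero]

theorem IsIsoparametricTwo.smul_normal (hF : IsOrientedHypersurface I F N)
    (h : IsIsoparametricTwo I F N κ₁ κ₂ l) {σ : ℝ} (hσ : σ ≠ 0) :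
    IsIsoparametricTwo I F (fun x => σ • N x) (σ * κ₁) (σ * κ₂) l := by
  obtain ⟨hl0, hl, hne, κ, hi, hκ, h₁, h₂⟩ := h
  refine ⟨hl0, hl, fun h => hne (mul_left_cancel₀ hσ h), fun i => σ * κ i, fun x => ?_,
    fun i => (hκ i).imp (congrArg _) (congrArg _), ?_, ?_⟩
  · obtain ⟨e, he⟩ := hi x
    refine ⟨e, fun i j => ⟨(he i j).1, ?_⟩⟩
    have := (he i j).2
    rw [secondFundamentalForm] at this ⊢
    rw [differential_smul hF.smooth_normal, smul_apply, inner_smul_left,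
      ← mul_neg, this]
    split_ifs <;> simp
  · simpa [hσ] using h₁
  · simpa [hσ] using h₂

theorem IsIsoparametricTwo.swap (h : IsIsoparametricTwo I F N κ₁ κ₂ l) :
    IsIsoparametricTwo I F N κ₂ κ₁ (n - l) := by
  obtain ⟨hl0, hl, hne, κ, hi, hκ, h₁, h₂⟩ := h
  exact ⟨by omega, by omega, hne.symm, κ, hi, fun i => (hκ i).symm, h₂, by rw [h₁]; omega⟩

theorem exists_sign_mul_pos {k : ℝ} (hk : k ≠ 0) : ∃ σ : ℝ, (σ = 1 ∨ σ = -1) ∧ 0 < σ * k := by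
  rcases hk.lt_or_gt with h | h
  · exact ⟨-1, Or.inr rfl, by linarith⟩
  · exact ⟨1, Or.inl rfl, by linarith⟩

theorem sqrt_lt_of_sign {σ k m m' : ℝ} (hσ : σ = 1 ∨ σ = -1) (hk : 0 < σ * k) (hm : 0 < m)
    (h : m' < m * k ^ 2) : √(m' / m) < σ * k := by
  rw [Real.sqrt_lt' hk, div_lt_iff₀ hm, mul_pow]
  have : σ ^ 2 = 1 := by rcases hσ with h | h <;> rw [h] <;> norm_num
  rw [this]
  linarith

/-- Normalization of the normal and of the labels of a hypersurface that is not minimal. -/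
theorem exists_normalization (hF : IsOrientedHypersurface I F N)
    (h : IsIsoparametricTwo I F N κ₁ κ₂ l) (hκκ : κ₁ * κ₂ = -1)
    (hmin : ¬ IsMinimalHypersurface I F N) : ∃ σ : ℝ, (σ = 1 ∨ σ = -1) ∧
      IsOrientedHypersurface I F (fun x => σ • N x) ∧
      ((IsIsoparametricTwo I F (fun x => σ • N x) (σ * κ₁) (σ * κ₂) l ∧
          √(((n : ℝ) - l) / l) < σ * κ₁) ∨
        (IsIsoparametricTwo I F (fun x => σ • N x) (σ * κ₂) (σ * κ₁) (n - l) ∧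
          √((l : ℝ) / ((n : ℝ) - l)) < σ * κ₂)) := by
  have habs : ∀ {σ : ℝ}, σ = 1 ∨ σ = -1 → |σ| = 1 := by rintro σ (rfl | rfl) <;> simp
  have hne0 : ∀ {σ : ℝ}, σ = 1 ∨ σ = -1 → σ ≠ 0 := by rintro σ (rfl | rfl) <;> norm_num
  have hκ₁ : κ₁ ≠ 0 := fun h0 => by rw [h0] at hκκ; norm_num at hκκ
  have hκ₂ : κ₂ ≠ 0 := fun h0 => by rw [h0] at hκκ; norm_num at hκκ
  have h' := h
  obtain ⟨hl0, hl, hne, κ, hi, hκ, h₁, h₂⟩ := h'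
  have hl0' : (0 : ℝ) < l := Nat.cast_pos.2 hl0
  have hl' : (0 : ℝ) < n - l := sub_pos.2 (Nat.cast_lt.2 hl)
  have hH : (l : ℝ) * κ₁ + (n - l) * κ₂ ≠ 0 := fun h0 => hmin fun x => by
    refine ⟨κ, hi x, ?_⟩
    rw [← h0]
    exact (sum_comp_eq_of_ncard hne hκ h₁ h₂ hl.le id).symm
  -- Multiplying `H` by `κ₁` gives `l κ₁² - (n - l)`. If it is positive, the labels are kept; if
  -- negative, multiplying by `κ₂²` gives the same inequality with the labels exchanged.
  have hH' : (n : ℝ) - l ≠ l * κ₁ ^ 2 := fun h0 => hH (mul_left_cancel₀ hκ₁ (by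
    linear_combination -h0 + ((n : ℝ) - l) * hκκ))
  rcases hH'.lt_or_gt with hlt | hlt
  · obtain ⟨σ, hσ, hpos⟩ := exists_sign_mul_pos hκ₁
    exact ⟨σ, hσ, hF.smul_normal (habs hσ), Or.inl ⟨h.smul_normal hF (hne0 hσ),
      sqrt_lt_of_sign hσ hpos hl0' hlt⟩⟩
  · obtain ⟨σ, hσ, hpos⟩ := exists_sign_mul_pos hκ₂
    refine ⟨σ, hσ, hF.smul_normal (habs hσ), Or.inr ⟨h.swap.smul_normal hF (hne0 hσ),
      sqrt_lt_of_sign hσ hpos hl' ?_⟩⟩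
    have := mul_lt_mul_of_pos_right hlt (pow_pos (abs_pos.2 hκ₂) 2)
    rw [sq_abs] at this
    calc (l : ℝ) = l * κ₁ ^ 2 * κ₂ ^ 2 := by
          linear_combination (-(l : ℝ)) * (κ₁ * κ₂ - 1) * hκκ
      _ < _ := this

/-- `F` and `N` have norm one, so the error is bounded by the differences of the cosines and sines,
independently of the point. -/
theorem tendstoUniformly_parallelMap (hF : IsOrientedHypersurface I F N) {α : Type*}
    {p : Filter α} {ξ : α → ℝ} {θ : ℝ} (h : Tendsto ξ p (𝓝 θ)) :
    TendstoUniformly (fun t => parallelMap F N (ξ t)) (parallelMap F N θ) p := by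
  rw [Metric.tendstoUniformly_iff]
  intro ε hε
  have hc : Tendsto (fun t => |Real.cos θ - Real.cos (ξ t)| + |Real.sin θ - Real.sin (ξ t)|) p
      (𝓝 0) := by
    have h1 := ((tendsto_const_nhds (x := Real.cos θ)).sub
      ((Real.continuous_cos.tendsto θ).comp h)).abs
    have h2 := ((tendsto_const_nhds (x := Real.sin θ)).sub
      ((Real.continuous_sin.tendsto θ).comp h)).abs
    simpa using h1.add h2
  filter_upwards [hc.eventually_lt_const hε] with t ht x
  refine lt_of_le_of_lt ?_ ht
  have : parallelMap F N θ x - parallelMap F N (ξ t) x =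
      (Real.cos θ - Real.cos (ξ t)) • F x + (Real.sin θ - Real.sin (ξ t)) • N x := by
    simp only [parallelMap]; module
  rw [dist_eq_norm, this]
  refine (norm_add_le _ _).trans_eq ?_
  rw [norm_smul, norm_smul, hF.mem_sphere, hF.norm_normal]
  simp

variable [FiniteDimensional ℝ E] [IsManifold I ∞ M] [BoundarylessManifold I M]

theorem mul_eq_neg_one_of_isoparametric [Nonempty M] (hF : IsOrientedHypersurface I F N)
    (h : IsIsoparametricTwo I F N κ₁ κ₂ l) : κ₁ * κ₂ = -1 := by
  obtain ⟨hl0, hl, hne, κ, hi, hκ, h₁, h₂⟩ := h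
  obtain ⟨x⟩ := ‹Nonempty M›
  obtain ⟨i₁, hi₁⟩ := exists_index_of_ncard h₁ hl0
  obtain ⟨i₂, hi₂⟩ := exists_index_of_ncard h₂ (by omega)
  exact (hi.isLocalIsoparametric hF x).mul_eq_neg_one hF.finrank_eq hκ hne hi₁ hi₂
    (mem_chartInterior I x)

/-- The parallel map at the first focal distance. -/
theorem isFocalSubmanifold_range_parallelMap [PreconnectedSpace M] [Nonempty M]
    (hF : IsOrientedHypersurface I F N)
    (hi : IsIsoparametric I F N κ) (hκ : ∀ i, κ i = κ₁ ∨ κ i = κ₂) (hne : κ₁ ≠ κ₂)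
    (h₁ : {i | κ i = κ₁}.ncard = l) (h₂ : {i | κ i = κ₂}.ncard = n - l) (hl0 : 0 < l)
    (hκκ : κ₁ * κ₂ = -1) {θ : ℝ} (hθ : Real.cos θ = κ₁ * Real.sin θ) :
    (∀ x, finrank ℝ (differential I (parallelMap F N θ) x).range = n - l) ∧
      IsFocalSubmanifold I F N (n - l) (range (parallelMap F N θ)) := by
  have hsin : Real.sin θ ≠ 0 := fun h0 => by
    have := Real.cos_sq_add_sin_sq θ
    rw [hθ, h0] at this
    norm_num at this
  have hset : {i | Real.cos θ - κ i * Real.sin θ ≠ 0} = {i | κ i = κ₂} := by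
    ext i
    change Real.cos θ - κ i * Real.sin θ ≠ 0 ↔ κ i = κ₂
    rw [hθ, ← sub_mul, mul_ne_zero_iff_right hsin, sub_ne_zero]
    rcases hκ i with h | h <;> simp [h, hne]
  have hrank : ∀ x, finrank ℝ (differential I (parallelMap F N θ) x).range = n - l := fun x => by
    rw [finrank_range_differential_parallelMap hF hi, hset, h₂]
  have hfocal : ∀ x, IsFocalAt I F N θ x := fun x hinj => by
    obtain ⟨i₁, hi₁⟩ := exists_index_of_ncard h₁ hl0
    refine ne_zero_of_injective_differential hF hi hinj i₁ ?_
    rw [hi₁, hθ, sub_self]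
  have hG : ContMDiff I 𝓘(ℝ, Amb n) ∞ (parallelMap F N θ) :=
    contMDiff_add_smul I hF.smooth hF.smooth_normal _ _
  refine ⟨hrank, ?_, ?_, θ, rfl, fun x => ⟨hfocal x, hrank x⟩⟩
  · have hP : ContMDiff I 𝓘(ℝ, Amb n) ∞ (focalMap F N κ₁) := by
      have h1 : focalMap F N κ₁ = fun z => (1 : ℝ) • N z + κ₁ • F z := by
        funext z; simp [focalMap]
      rw [h1]
      exact contMDiff_add_smul I hF.smooth_normal hF.smooth 1 κ₁
    -- At the focal distance `cos θ = κ₁ sin θ`, so the parallel map is a nonzero multiple of the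
    -- focal map and has the same span.
    have hPG : parallelMap F N θ = fun z => Real.sin θ • focalMap F N κ₁ z := by
      funext z
      rw [parallelMap, focalMap, hθ]
      module
    have hspan : ∀ x, Submodule.span ℝ {parallelMap F N θ x} ⊔
        (differential I (parallelMap F N θ) x).range =
        Submodule.span ℝ {focalMap F N κ₁ x} ⊔ (differential I (focalMap F N κ₁) x).range := by
      intro x
      rw [hPG, differential_smul hP, Submodule.span_singleton_smul_eq (IsUnit.mk0 _ hsin),
        ContinuousLinearMap.toLinearMap_smul, LinearMap.range_smul _ _ hsin]
    obtain ⟨x₀⟩ := ‹Nonempty M›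
    refine isEmbeddedSubmanifold_range hG (norm_parallelMap hF θ)
      (Submodule.span ℝ {parallelMap F N θ x₀} ⊔ (differential I (parallelMap F N θ) x₀).range)
      (fun x => ?_) ?_
    · rw [hspan, hspan]
      exact focalSpan_eq hF hi hκ hne hκκ x x₀
    · rw [Submodule.finrank_span_singleton_sup, hrank]
      · intro h0
        have := norm_parallelMap hF θ x₀
        rw [h0, norm_zero] at this
        exact zero_ne_one this
      · rintro _ ⟨v, rfl⟩
        have := inner_differential_add_inner_differential_eq_zero I hG hG (c := 1)
          (fun x => by rw [real_inner_self_eq_norm_sq, norm_parallelMap hF, one_pow]) x₀ v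
        rw [real_inner_comm (parallelMap F N θ x₀)] at this
        rw [ContinuousLinearMap.coe_coe]
        linarith
  · rintro _ ⟨x, rfl⟩
    simpa using norm_parallelMap hF θ x

end TwoPrincipalCurvatures

end

/-! ### The main theorem. -/

theorem proposition2p7 {n l : ℕ}
    {E : Type*} [NormedAddCommGroup E] [NormedSpace ℝ E]
    {H : Type*} [TopologicalSpace H] (I : ModelWithCorners ℝ E H)
    {M : Type*} [TopologicalSpace M] [ChartedSpace H M] [IsManifold I ∞ M]
    [BoundarylessManifold I M] [ConnectedSpace M]
    (F N : M → Amb n) (κ₁ κ₂ : ℝ)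
    (hF : IsOrientedHypersurface I F N)
    (hκ : IsIsoparametricTwo I F N κ₁ κ₂ l) :
    κ₁ * κ₂ = -1 ∧
    -- after a choice of the normal and of the labels, `κ₁ > √((n - l) / l)`
    (¬ IsMinimalHypersurface I F N → ∃ σ : ℝ, (σ = 1 ∨ σ = -1) ∧
      IsOrientedHypersurface I F (fun x => σ • N x) ∧
      ((IsIsoparametricTwo I F (fun x => σ • N x) (σ * κ₁) (σ * κ₂) l ∧
          √(((n : ℝ) - l) / l) < σ * κ₁) ∨
        (IsIsoparametricTwo I F (fun x => σ • N x) (σ * κ₂) (σ * κ₁) (n - l) ∧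
          √((l : ℝ) / ((n : ℝ) - l)) < σ * κ₂))) ∧
    (√(((n : ℝ) - l) / l) < κ₁ →
      ∀ (a b tstar : ℝ) (q : ℝ → ℝ), a = κ₁ + κ₂ →
      b = -(((n : ℝ) - 2 * l) / n) * (κ₁ - κ₂) →
      (∀ t, q t = (a + b) * Real.exp (2 * n * t) - b) →
      tstar = 1 / (2 * n) * Real.log (l * (κ₁ ^ 2 + 1) / (l * (κ₁ ^ 2 + 1) - n)) →
      0 < l * (κ₁ ^ 2 + 1) - n ∧ 0 < tstar ∧
      ∃ ξ : ℝ → ℝ, ContDiffOn ℝ ∞ ξ (Ico 0 tstar) ∧ ξ 0 = 0 ∧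
        (∀ t ∈ Ico 0 tstar, 0 < a ^ 2 + 4 - q t ^ 2 ∧
          Real.cos (2 * ξ t) = (a * q t + 2 * √(a ^ 2 + 4 - q t ^ 2)) / (a ^ 2 + 4) ∧
          Real.sin (2 * ξ t) = (2 * q t - a * √(a ^ 2 + 4 - q t ^ 2)) / (a ^ 2 + 4)) ∧
        IsParallelMCF I F N (fun t => parallelMap F N (ξ t)) (Ico 0 tstar) ∧
        -- it is the only solution by parallel hypersurfaces, and it does not extend to `tstar`
        (∀ (T : ℝ) (Ghat : ℝ → M → Amb n), 0 < T → IsParallelMCF I F N Ghat (Ico 0 T) →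
          T ≤ tstar ∧ ∀ t ∈ Ico 0 T, Ghat t = parallelMap F N (ξ t)) ∧
        -- collapse into a focal submanifold
        ∃ θ : ℝ, 0 < θ ∧ θ < Real.pi / 2 ∧ Real.cot θ = κ₁ ∧
          Tendsto ξ (𝓝[<] tstar) (𝓝 θ) ∧
          TendstoUniformly (fun t => parallelMap F N (ξ t)) (parallelMap F N θ) (𝓝[<] tstar) ∧
          (∀ x, finrank ℝ (differential I (parallelMap F N θ) x).range = n - l) ∧
          IsFocalSubmanifold I F N (n - l) (range (parallelMap F N θ))) := by
  have hn0 : 0 < n := hκ.1.trans hκ.2.1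
  have : FiniteDimensional ℝ E := FiniteDimensional.of_finrank_pos (by rwa [hF.finrank_eq])
  have hκκ := mul_eq_neg_one_of_isoparametric hF hκ
  refine ⟨hκκ, exists_normalization hF hκ hκκ, ?_⟩
  obtain ⟨hl0, hl, hne, κ, hi, hκ, h₁, h₂⟩ := hκ
  rintro hlarge a b tstar q rfl hb hq ht
  have hn0' : (0 : ℝ) < n := Nat.cast_pos.2 hn0
  have hl0' : (0 : ℝ) < l := Nat.cast_pos.2 hl0
  have hl' : (l : ℝ) < n := Nat.cast_lt.2 hl
  have hκ₁ : 0 < κ₁ := (Real.sqrt_nonneg _).trans_lt hlarge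
  have hD : 0 < l * (κ₁ ^ 2 + 1) - n := by
    rw [Real.sqrt_lt' hκ₁, div_lt_iff₀ hl0'] at hlarge
    linarith
  have hκ₂ : κ₂ < κ₁ := by nlinarith
  have hw0 : 0 < κ₁ - κ₂ := sub_pos.2 hκ₂
  have hw : (κ₁ + κ₂) ^ 2 + 4 = (κ₁ - κ₂) ^ 2 := by linear_combination 4 * hκκ
  have hb' : n * b = (2 * l - n) * (κ₁ - κ₂) := by
    rw [hb]
    field_simp
    ring
  -- The hypothesis on `κ₁` is thus equivalent to `a + b > 0`, which makes `q` strictly increasing.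
  have hA' : n * κ₁ * (κ₁ + κ₂ + b) = 2 * (l * (κ₁ ^ 2 + 1) - n) := by
    linear_combination κ₁ * hb' + 2 * (n - l) * hκκ
  have hA : 0 < κ₁ + κ₂ + b := by
    have : 0 < n * κ₁ * (κ₁ + κ₂ + b) := by rw [hA']; linarith
    exact (mul_pos_iff_of_pos_left (by positivity)).1 this
  have hratio : 1 < l * (κ₁ ^ 2 + 1) / (l * (κ₁ ^ 2 + 1) - n) := by
    rw [one_lt_div hD]; linarith
  have htpos : 0 < tstar := by
    rw [ht]
    exact mul_pos (by positivity) (Real.log_pos hratio)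
  -- `κ₁ - κ₂` is `√(a² + 4)`: the time `t*` is where `q` reaches the boundary of the arcsine
  -- domain.
  have hqstar : q tstar = κ₁ - κ₂ := by
    have h1 : 2 * n * tstar = Real.log (l * (κ₁ ^ 2 + 1) / (l * (κ₁ ^ 2 + 1) - n)) := by
      rw [ht]; field_simp
    rw [hq, h1, Real.exp_log (by linarith)]
    refine mul_left_cancel₀ (mul_pos hn0' hκ₁).ne' ?_
    rw [mul_sub, ← mul_assoc, hA']
    field_simp
    linear_combination -κ₁ * hb' + 2 * l * hκκ
  have hqmono : StrictMono q := by
    intro u v huv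
    rw [hq, hq]
    have : Real.exp (2 * n * u) < Real.exp (2 * n * v) := Real.exp_lt_exp.2 (by gcongr)
    linarith [mul_lt_mul_of_pos_left this hA]
  have hq0 : q 0 = κ₁ + κ₂ := by rw [hq]; simp
  have hqT : ∀ t ∈ Ico 0 tstar, q t ^ 2 < (κ₁ + κ₂) ^ 2 + 4 := by
    intro t ht
    rw [hw]
    have h1 := hqmono ht.2
    have h2 := hqmono.monotone ht.1
    rw [hqstar] at h1
    rw [hq0] at h2
    exact sq_lt_sq' (by linarith) h1
  have hqs : ContDiff ℝ ∞ q := by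
    rw [funext hq]
    fun_prop
  have hflow := isParallelMCF_focalAngle hF hi hκ hne h₁ h₂ hl hκκ hb' hq hqT
  obtain ⟨hθ0, hθ1, hθ⟩ := focalAngle_sqrt hκκ hκ₂
  have hlim : Tendsto (fun t => focalAngle (κ₁ + κ₂) (q t)) (𝓝[<] tstar)
      (𝓝 (focalAngle (κ₁ + κ₂) (κ₁ - κ₂))) := by
    rw [← hqstar]
    exact (((continuous_focalAngle _).comp hqs.continuous).tendsto tstar).mono_left
      nhdsWithin_le_nhds
  refine ⟨hD, htpos, fun t => focalAngle (κ₁ + κ₂) (q t), fun t ht =>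
    ((contDiffAt_focalAngle (hqT t ht)).comp t hqs.contDiffAt).contDiffWithinAt,
    by simp only [hq0, focalAngle_self], fun t ht => ⟨by linarith [hqT t ht],
      cos_two_mul_focalAngle (hqT t ht).le, sin_two_mul_focalAngle (hqT t ht).le⟩, hflow, ?_, ?_⟩
  · intro T Ghat hT hG
    obtain ⟨ξ, hξ⟩ := hG.exists_angle hF hi hκ hne h₁ h₂ hl0 hl hκκ hb'
    obtain ⟨ξ', hξ'⟩ := hflow.exists_angle hF hi hκ hne h₁ h₂ hl0 hl hκκ hb'
    have hTle : T ≤ tstar := by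
      by_contra hlt
      obtain ⟨-, hp₁, hp₂, hQ⟩ := hξ tstar ⟨htpos.le, not_le.1 hlt⟩
      -- A solution alive at `t*` would have `P² = a² + 4 - q(t*)² = 0`, against the positivity of
      -- both focal factors.
      have h3 := focal_product_sq hκκ (Real.cos_sq_add_sin_sq (ξ tstar))
      rw [hQ, ← hq, hqstar, hw] at h3
      have h4 := pow_pos (mul_pos two_pos (mul_pos hp₁ hp₂)) 2
      linarith
    refine ⟨hTle, fun t ht => ?_⟩
    obtain ⟨hGt, hp₁, hp₂, hQ⟩ := hξ t ht
    obtain ⟨hGt', hp₁', hp₂', hQ'⟩ := hξ' t ⟨ht.1, ht.2.trans_le hTle⟩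
    obtain ⟨hc, hs⟩ := angle_unique hκκ (Real.cos_sq_add_sin_sq _) (Real.cos_sq_add_sin_sq _)
      hp₁ hp₂ hp₁' hp₂' (hQ.trans hQ'.symm)
    rw [hGt]
    refine Eq.trans ?_ hGt'.symm
    funext x
    rw [parallelMap, parallelMap, hc, hs]
  · obtain ⟨hrank, hfocal⟩ := isFocalSubmanifold_range_parallelMap hF hi hκ hne h₁ h₂ hl0 hκκ hθ
    refine ⟨_, hθ0, hθ1, ?_, hlim, tendstoUniformly_parallelMap hF hlim, hrank, hfocal⟩
    rw [Real.cot_eq_cos_div_sin, hθ, mul_div_assoc, div_self, mul_one]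
    exact (Real.sin_pos_of_pos_of_lt_pi hθ0 (by linarith [Real.pi_pos])).ne'
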